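/- **Setting.** Let $(\mathcal C,\mathcal M)$ be an adhesive HLR category: $\mathcal M$ is a class of monomorphisms containing all isomorphisms, closed under composition and decomposition ($g\circ f,\,g\in\mathcal M\Rightarrow f\in\mathcal M$), pushouts and pullbacks along $\mathcal M$-morphisms exist, $\mathcal M$ is stable under pushout and pullback, and pushouts along $\mathcal M$-morphisms are van Kampen squares. Assume moreover that $\mathcal C$ has all pullbacks, binary coproducts, initial pushouts over $\mathcal M$-morphisms, an $\mathcal M$-initial object $\bot$ (initial, with all outgoing morphisms in $\mathcal M$), and a unique $\mathcal E'$-$\mathcal M$ factorization of cospans: $\mathcal E'$ is an isomorphism-closed class of cospans, and every cospan factors, uniquely up to isomorphism, as a cospan in $\mathcal E'$ followed by a morphism in $\mathcal M$. **Conditions.** Conditions over $P$ are generated by $\mathrm{true}$, Boolean combinations (possibly infinite) and $\exists(p\colon P\to Q,d)$ with $d$ a condition over $Q$. A morphism $q\colon P\to G$ satisfies $\exists(p,d)$ iff $q=q'\circ p$ for some $q'\in\mathcal M$ with $q'\models d$. $\mathrm{Shift}$ and $\mathrm{Left}$ are the usual operations: they commute with Boolean combinations; $\mathrm{Shift}(b,\exists(a,d))=\bigvee\exists(a',\mathrm{Shift}(b',d))$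 over all $(a',b')\in\mathcal E'$ with $b'\in\mathcal M$, $a'\circ b=b'\circ a$; and, for a span $L\xleftarrow{l}K\xrightarrow{r}R$, $\mathrm{Left}((l,r),\exists(a,d))=\exists(b,\mathrm{Left}((l',r'),d))$ if $a\circ r$ has a pushout complement $K\xrightarrow{z}Z\xrightarrow{r'}Q$, where $L\xrightarrow{b}Y\xleftarrow{l'}Z$ is the pushout of $l$ and $z$, and it is false otherwise. The tree of a condition over $P_0$ has the root $P_0$ and one edge for each quantified morphism; a leaf is a node without outgoing edges. A non-root node is existentially (universally) bound if its quantifier $\exists$ stands under an even (odd) number of negations, i.e. is $\exists$ ($\forall$) after pushing all negations inwards. **Rules and transformations.** A rule is $\rho=(L\xleftarrow{l}K\xrightarrow{r}R,\mathit{ac})$ with $l,r\in\mathcal M$ and $\mathit{ac}$ a condition over $L$ in which all morphisms, except possibly those starting at $L$, are in $\mathcal M$. An ac-disregarding transformation $t\colon G\Rightarrow_{\rho,m}H$ consists of two pushouts from $L\xleftarrow{l}K\xrightarrow{r}R$ to $G\xleftarrow{g}D\xrightarrow{h}H$ over the match $m\colon L\to G$ (an arbitrary morphism); it is a transformation if $m\models\mathit{ac}$.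 Transformations $t_1,t_2$ of $G$ via $\rho_1,\rho_2$ are parallel independent if there are $d_1\colon L_2\to D_1$, $d_2\colon L_1\to D_2$ with $g_1d_1=m_2$, $g_2d_2=m_1$, $h_1d_1\models\mathit{ac}_2$, $h_2d_2\models\mathit{ac}_1$, and parallel dependent otherwise. Ac-disregarding transformations are parallel independent ac-disregarding if $d_1,d_2$ with the two equations exist. **Overlaps.** A rule overlap of $\rho_1,\rho_2$ is $\mathit{ro}=(b_1\colon A\to P_1,\,b_2\colon A\to P_2,\,p_1\colon L_1\to P_1,\,p_2\colon L_2\to P_2)$. An embedding of it in a pair $(t_1,t_2)$ of (ac-disregarding) transformations of $G$ is a pair $q_j\colon P_j\to G$ with $q_jp_j=m_j$ such that $(b_1,b_2)$ is a pullback of $(q_1,q_2)$. The overlap is ac-conflicting if it embeds in some pair of ac-disregarding transformations via $\rho_1,\rho_2$ that is parallel independent ac-disregarding. A composition of $\mathit{ro}$ and $\mathit{ro}'$ is any overlap $(b_1^*,b_2^*,e_1p_1,e_2p_2)$ where $(e_j\colon P_j\to P_j^*,\,e_j'\colon P_j'\to P_j^*)\in\mathcal E'$ for $j=1,2$, $(f_1\colon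 P_1^*\to K^*,\,f_2\colon P_2^*\to K^*)\in\mathcal E'$ with $f_1,f_2\in\mathcal M$, $e_jp_j=e_j'p_j'$, $(b_1,b_2)$ is a pullback of $(f_1e_1,f_2e_2)$, $(b_1',b_2')$ is a pullback of $(f_1e_1',f_2e_2')$, and $(b_1^*,b_2^*)$ is a pullback of $(f_1,f_2)$. **Disabling essences.** For $l\colon K\to L$ in $\mathcal M$ and $m_1\colon L\to X$, $m_2\colon P\to X$, the proto-essence $\mathrm{Ess}_l(m_1,m_2)$ is obtained from the pullback $(a_1\colon A\to L,a_2\colon A\to P)$ of $(m_1,m_2)$, the pullback $(k\colon A'\to A,\,k'\colon A'\to K)$ of $(a_1,l)$, and the initial pushout over $k$, with essence object $E\to A$; it is trivial if $E\cong\bot$. As an overlap it is represented by the span $(a_1,a_2)$. Let $P_n$ be $L_2$ or a leaf of the tree of $\mathit{ac}_2$, with path $L_2=P_0\xrightarrow{p_1}P_1\to\dots\to P_n$ from the root (the empty path in the first case), and let $(e_{L},e_{P_n})\in\mathcal E'$ be a cospan of $L$ and $P_n$, where $e_{P_n}\in\mathcal M$ unless the path is empty. Put $e_{P_i}=e_{P_n}p_n\cdots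 p_{i+1}$. With $L=L_1$, the proto-essence by deletion at level $0$ is $\mathrm{Ess}_{l_1}(e_L,e_{P_0})$; at level $i\ge1$ it is the one at level $i-1$ if that is nontrivial, and $\mathrm{Ess}_{l_1}(e_L,e_{P_i})$ otherwise. Proto-essences by insertion are defined likewise with $L=R_1$ and $r_1$ in place of $l_1$, the recursion starting at level $1$. In both cases the result at level $n$ is taken; let $P_i$ be the object at which it was computed and $p\colon L_2\to P_i$ the path. A disabling essence of $\rho_1$ in $\rho_2$ by deletion is the overlap $(a_1\colon A\to L_1,\,a_2\colon A\to P_i,\,\mathrm{id}_{L_1},\,p)$ of a nontrivial proto-essence by deletion with $P_i$ existentially bound or the root $L_2$; one by insertion is the overlap $(l_1k'\colon A'\to L_1,\ a'\colon A'\to P_i',\ \mathrm{id}_{L_1},\ p'\colon L_2\to P_i')$ obtained from a nontrivial proto-essence by insertion with $P_i$ universally bound, where $A'\xrightarrow{a'}P_i'\xrightarrow{x}P_i$ is a pushout complement of $A'\xrightarrow{k}A\xrightarrow{a_2}P_i$ and $x\circ p'=p$. In both cases it is required that the overlap embeds via some cospan $(e_1,e_2)\in\mathcal E'$ into a pair of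 ac-disregarding transformations (whose matches are $e_1$ and $e_2$ composed with the given morphism from $L_2$). **Conflict essences.** The set $\mathrm{CE}(\rho_1,\rho_2)$ is the smallest set of overlaps of $\rho_1,\rho_2$ such that (1) it contains every disabling essence of $\rho_1$ in $\rho_2$, or of $\rho_2$ in $\rho_1$ (with the roles of the two rules exchanged), that is ac-conflicting or has $P_1=L_1$, $P_2=L_2$ with $p_1,p_2$ the identities; (2) it contains all compositions of any two of its elements that are both ac-conflicting or both not ac-conflicting. For ac-disregarding transformations $t_1,t_2$ of $G$ put $\mathit{ac}_G=\mathrm{Shift}(m_1,\mathit{ac}_1)\wedge\mathrm{Shift}(m_2,\mathit{ac}_2)$ and $\mathit{ac}^*_G=\neg(\mathit{ac}^*_{G,d_1}\wedge\mathit{ac}^*_{G,d_2})$, where $\mathit{ac}^*_{G,d_1}=\mathrm{Left}(G\xleftarrow{g_1}D_1\xrightarrow{h_1}H_1,\mathrm{Shift}(h_1d_1,\mathit{ac}_2))$ if $d_1\colon L_2\to D_1$ with $g_1d_1=m_2$ exists, and false otherwise; $\mathit{ac}^*_{G,d_2}$ is defined symmetrically. Let $\mathit{ac}_{L_1+L_2}$,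 $\mathit{ac}^*_{L_1+L_2}$ be these conditions for the transformations $R_1+L_2\Leftarrow L_1+L_2\Rightarrow L_1+R_2$ at the coproduct injections. A symbolic conflict essence of $\rho_1,\rho_2$ is a pair $(\mathit{ce},\mathit{ac}_{\mathit{ce}})$ with $\mathit{ce}=(b_1,b_2,p_1,p_2)\in\mathrm{CE}(\rho_1,\rho_2)$ where $\mathit{ac}_{\mathit{ce}}=\mathrm{true}$ if $\mathit{ce}$ is not ac-conflicting, and otherwise $\mathit{ac}_{\mathit{ce}}$ is the cospan condition $\exists(P_1\xrightarrow{d_1}D\xleftarrow{d_2}P_2,\ \mathrm{Shift}(m^*,\mathit{ac}_{L_1+L_2}\wedge\mathit{ac}^*_{L_1+L_2}))$, with $D$ the pushout of $(b_1,b_2)$ and $m^*=[d_1p_1,d_2p_2]\colon L_1+L_2\to D$. A pair $(q_1,q_2)$ satisfies $\exists(P_1\xrightarrow{d_1}D\xleftarrow{d_2}P_2,c)$ iff there is $f\colon D\to G$ with $fd_1=q_1$, $fd_2=q_2$ and $f\models c$. The pair $(\mathit{ce},\mathit{ac}_{\mathit{ce}})$ is embeddable in $(t_1,t_2)$ if some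 embedding $(q_1,q_2)$ of $\mathit{ce}$ in $(t_1,t_2)$ satisfies $\mathit{ac}_{\mathit{ce}}$. **Theorem (Correctness of symbolic conflict essences).** Let $t_1\colon G\Rightarrow_{\rho_1,m_1}H_1$ and $t_2\colon G\Rightarrow_{\rho_2,m_2}H_2$ be transformations via rules $\rho_1$ and $\rho_2$. Then $t_1$ and $t_2$ are parallel dependent if and only if some symbolic conflict essence $(\mathit{ce},\mathit{ac}_{\mathit{ce}})$ of $\rho_1$ and $\rho_2$ is embeddable in $(t_1,t_2)$. -/

import Mathlib

open CategoryTheory Limits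

universe v u

namespace ConflictEssences

variable {C : Type u} [Category.{v} C]

/-! ### The categorical setting -/

/-- `(C, M)` is an adhesive HLR category: `M` is a class of monomorphisms that contains the
identities and is closed under isomorphisms, composition and decomposition, pushouts and pullbacks
along `M`-morphisms exist, `M` is stable under pushouts and pullbacks (hence closed under
isomorphisms), and pushouts along `M`-morphisms are van Kampen squares. -/
structure IsAdhesiveHLR (M : MorphismProperty C) : Prop where
  mono : ∀ ⦃X Y : C⦄ (f : X ⟶ Y), M f → Mono f
  multiplicative : M.IsMultiplicative
  decomposition : ∀ ⦃X Y Z : C⦄ (f : X ⟶ Y) (g : Y ⟶ Z), M (f ≫ g) → M g → M f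
  hasPullback : ∀ ⦃X Y Z : C⦄ (f : X ⟶ Z) (g : Y ⟶ Z), M f → HasPullback f g
  hasPushout : ∀ ⦃X Y Z : C⦄ (f : X ⟶ Y) (g : X ⟶ Z), M f → HasPushout f g
  stableUnderBaseChange : M.IsStableUnderBaseChange
  stableUnderCobaseChange : M.IsStableUnderCobaseChange
  vanKampen : ∀ ⦃W X Y Z : C⦄ {f : W ⟶ X} {g : W ⟶ Y} {h : X ⟶ Z} {i : Y ⟶ Z}
    (H : IsPushout f g h i), M f → H.IsVanKampen

/-- The square with sides `b : B ⟶ A`, `b' : B ⟶ E`, `f : A ⟶ A'`, `c : E ⟶ A'` is an initial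
pushout over `f`: it is a pushout with `b, c ∈ M`, and it factors uniquely, via a pushout, through every other
pushout over `f` whose vertical morphisms are in `M`. -/
structure IsInitialPushout (M : MorphismProperty C) {A A' B E : C}
    (f : A ⟶ A') (b : B ⟶ A) (b' : B ⟶ E) (c : E ⟶ A') : Prop where
  isPushout : IsPushout b b' f c
  mem_left : M b
  mem_right : M c
  initial : ∀ ⦃D D' : C⦄ (d : D ⟶ A) (d' : D ⟶ D') (e : D' ⟶ A'),
    IsPushout d d' f e → M d → M e →
      ∃! p : (B ⟶ D) × (E ⟶ D'),
        p.1 ≫ d = b ∧ p.2 ≫ e = c ∧ M p.1 ∧ M p.2 ∧ IsPushout p.1 b' d' p.2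

/-- Initial pushouts over `M`-morphisms exist. -/
def HasInitialPushouts (M : MorphismProperty C) : Prop :=
  ∀ ⦃A A' : C⦄ (f : A ⟶ A'), M f →
    ∃ (B E : C) (b : B ⟶ A) (b' : B ⟶ E) (c : E ⟶ A'), IsInitialPushout M f b b' c

/-- There is an `M`-initial object, i.e. an initial object all of whose outgoing morphisms are in
`M`. -/
def HasMInitial (M : MorphismProperty C) : Prop :=
  ∃ (I : C) (hI : IsInitial I), ∀ A : C, M (hI.to A)

/-- A unique `E'`-`M` factorization of cospans: an isomorphism-closed class `E'` of cospans such
that every cospan is, uniquely up to isomorphism, a cospan in `E'` followed by a morphism in `M`. -/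
structure PairFactorization (M : MorphismProperty C) where
  /-- the class `E'` -/
  E' : ∀ ⦃A B X : C⦄, (A ⟶ X) → (B ⟶ X) → Prop
  comp_iso : ∀ ⦃A B X Y : C⦄ (e : A ⟶ X) (e' : B ⟶ X) (i : X ⟶ Y) [IsIso i],
    E' e e' → E' (e ≫ i) (e' ≫ i)
  exists_fac : ∀ ⦃A B G : C⦄ (f : A ⟶ G) (g : B ⟶ G),
    ∃ (X : C) (e : A ⟶ X) (e' : B ⟶ X) (m : X ⟶ G),
      E' e e' ∧ M m ∧ e ≫ m = f ∧ e' ≫ m = g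
  unique_fac : ∀ ⦃A B G X Y : C⦄ (e : A ⟶ X) (e' : B ⟶ X) (m : X ⟶ G)
    (d : A ⟶ Y) (d' : B ⟶ Y) (n : Y ⟶ G), E' e e' → M m → E' d d' → M n →
      e ≫ m = d ≫ n → e' ≫ m = d' ≫ n →
        ∃ i : X ≅ Y, e ≫ i.hom = d ∧ e' ≫ i.hom = d' ∧ i.hom ≫ n = m

/-! ### Nested conditions -/

/-- Nested conditions over an object. Boolean combinations are generated by negation and
(possibly infinite) conjunction; disjunction, falsity and universal quantification are derived. -/
inductive Cond : C → Type (max (u + 1) (v + 1)) where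
  | tt (P : C) : Cond P
  | neg {P : C} (c : Cond P) : Cond P
  | conj {P : C} (I : Type (max u v)) (c : I → Cond P) : Cond P
  | ex {P Q : C} (p : P ⟶ Q) (d : Cond Q) : Cond P

namespace Cond

def ff (P : C) : Cond P := neg (tt P)

def and {P : C} (c d : Cond P) : Cond P :=
  conj (ULift.{max u v} Bool) (fun i => bif i.down then c else d)

def disj {P : C} (I : Type (max u v)) (c : I → Cond P) : Cond P :=
  neg (conj I (fun i => neg (c i)))

def all {P Q : C} (p : P ⟶ Q) (d : Cond Q) : Cond P := neg (ex p (neg d))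

/-- `Sat M q c`: the morphism `q` satisfies the condition `c`. -/
def Sat (M : MorphismProperty C) {G : C} : ∀ {P : C}, (P ⟶ G) → Cond P → Prop
  | _, _, tt _ => True
  | _, q, neg c => ¬ Sat M q c
  | _, q, conj _ c => ∀ i, Sat M q (c i)
  | _, q, ex (Q := Q) p d => ∃ q' : Q ⟶ G, M q' ∧ p ≫ q' = q ∧ Sat M q' d

/-- All morphisms occurring in the condition are in `M`. -/
def AllInM (M : MorphismProperty C) : ∀ {P : C}, Cond P → Prop
  | _, tt _ => True
  | _, neg c => AllInM M c
  | _, conj _ c => ∀ i, AllInM M (c i)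
  | _, ex p d => M p ∧ AllInM M d

/-- `M`-normal form: all morphisms occurring in the condition are in `M`, except possibly those
that start at the object over which the condition is defined. -/
def IsMNormal (M : MorphismProperty C) : ∀ {P : C}, Cond P → Prop
  | _, tt _ => True
  | _, neg c => IsMNormal M c
  | _, conj _ c => ∀ i, IsMNormal M (c i)
  | _, ex _ d => AllInM M d

/-- The index set of the disjunction in `Shift (b, ∃ (a, d))`: all cospans `(a', b') ∈ E'` with
`b' ∈ M` that close the span `(a, b)` to a commutative square. -/
structure ShiftIndex {M : MorphismProperty C} (F : PairFactorization M) {P P' Q : C}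
    (b : P ⟶ P') (a : P ⟶ Q) : Type (max u v) where
  obj : C
  a' : P' ⟶ obj
  b' : Q ⟶ obj
  mem : F.E' a' b'
  mem_M : M b'
  comm : b ≫ a' = a ≫ b'

/-- The shift of a condition along a morphism. -/
def shift {M : MorphismProperty C} (F : PairFactorization M) :
    ∀ {P P' : C}, (P ⟶ P') → Cond P → Cond P'
  | _, P', _, tt _ => tt P'
  | _, _, b, neg c => neg (shift F b c)
  | _, _, b, conj I c => conj I (fun i => shift F b (c i))
  | _, _, b, ex p d => disj (ShiftIndex F b p) (fun i => ex i.a' (shift F i.b' d))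

/-- One step of the left-translation of a condition over the plain rule `(l : K ⟶ L, r : K ⟶ R)`: a pushout
complement `K ⟶ Z ⟶ Q` of `r` and `a : R ⟶ Q`, and a pushout `Y` of `l` and `K ⟶ Z`. -/
structure LeftStep {L K R Q : C} (l : K ⟶ L) (r : K ⟶ R) (a : R ⟶ Q) where
  Z : C
  k : K ⟶ Z
  r' : Z ⟶ Q
  Y : C
  b : L ⟶ Y
  l' : Z ⟶ Y
  isPushout_right : IsPushout r k a r'
  isPushout_left : IsPushout l k b l'

open Classical in
/-- The left-translation over the plain rule `(l : K ⟶ L, r : K ⟶ R)` of a condition over `R`. -/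
noncomputable def left : ∀ {L K R : C}, (K ⟶ L) → (K ⟶ R) → Cond R → Cond L
  | L, _, _, _, _, tt _ => tt L
  | _, _, _, l, r, neg c => neg (left l r c)
  | _, _, _, l, r, conj I c => conj I (fun i => left l r (c i))
  | L, _, _, l, r, ex p d =>
    if h : Nonempty (LeftStep l r p) then
      ex h.some.b (left h.some.l' h.some.r' d)
    else ff L

/-- The condition contains no quantifier; the tree of the condition is a single node. -/
def IsEdgeless : ∀ {P : C}, Cond P → Prop
  | _, tt _ => True
  | _, neg c => IsEdgeless c
  | _, conj _ c => ∀ i, IsEdgeless (c i)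
  | _, ex _ _ => False

end Cond

/-- How a node of the tree of a condition is bound: it is the root, or it is bound by a quantifier
that is existential (resp. universal) once all negations are pushed inwards. -/
inductive Binder where
  | root
  | exist
  | univ

/-- The kind of a quantifier `∃` under an even (`true`) or odd (`false`) number of negations. -/
def Binder.ofPolarity (pol : Bool) : Binder := bif pol then .exist else .univ

/-- A composable chain of morphisms `P = P₀ ⟶ P₁ ⟶ ⋯ ⟶ Pₙ = R` together with the binders of
`P₁, …, Pₙ`. -/
inductive Chain : C → C → Type (max u v) where
  | nil (P : C) : Chain P P
  | cons {P Q R : C} (k : Binder) (p : P ⟶ Q) (t : Chain Q R) : Chain P R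

/-- `IsRootLeafPath pol c ch`: the chain `ch` is a path from the root to a leaf of the tree of `c`,
where `c` occurs with polarity `pol`. A leaf is a node without outgoing edges. -/
inductive IsRootLeafPath : ∀ {P R : C}, Bool → Cond P → Chain P R → Prop
  | leaf {P : C} (pol : Bool) (c : Cond P) : c.IsEdgeless → IsRootLeafPath pol c (Chain.nil P)
  | neg {P Q R : C} (pol : Bool) (c : Cond P) (k : Binder) (p : P ⟶ Q) (t : Chain Q R) :
      IsRootLeafPath (!pol) c (Chain.cons k p t) →
      IsRootLeafPath pol (Cond.neg c) (Chain.cons k p t)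
  | conj {P Q R : C} (pol : Bool) (I : Type (max u v)) (c : I → Cond P) (i : I)
      (k : Binder) (p : P ⟶ Q) (t : Chain Q R) :
      IsRootLeafPath pol (c i) (Chain.cons k p t) →
      IsRootLeafPath pol (Cond.conj I c) (Chain.cons k p t)
  | ex {P Q R : C} (pol : Bool) (p : P ⟶ Q) (d : Cond Q) (t : Chain Q R) :
      IsRootLeafPath pol d t →
      IsRootLeafPath pol (Cond.ex p d) (Chain.cons (Binder.ofPolarity pol) p t)

/-- A level of a chain from `P` to `R`: an object `Pᵢ` of the chain, its binder, and the composites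
`P ⟶ Pᵢ` and `Pᵢ ⟶ R` along the chain. -/
structure Level (P R : C) where
  obj : C
  binder : Binder
  fromRoot : P ⟶ obj
  toLeaf : obj ⟶ R

namespace Chain

def comp : ∀ {P R : C}, Chain P R → (P ⟶ R)
  | _, _, nil P => 𝟙 P
  | _, _, cons _ p t => p ≫ t.comp

def length : ∀ {P R : C}, Chain P R → ℕ
  | _, _, nil _ => 0
  | _, _, cons _ _ t => t.length + 1

/-- The levels `P₀, …, Pₙ` of a chain whose first object has binder `k`. -/
def levelsFrom : ∀ {P R : C}, Binder → Chain P R → List (Level P R)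
  | _, _, k, nil P => [⟨P, k, 𝟙 P, 𝟙 P⟩]
  | P, _, k, cons k' p t =>
    ⟨P, k, 𝟙 P, p ≫ t.comp⟩ ::
      (t.levelsFrom k').map (fun ℓ => ⟨ℓ.obj, ℓ.binder, p ≫ ℓ.fromRoot, ℓ.toLeaf⟩)

/-- The levels `P₀, …, Pₙ` of a chain starting at a root. -/
def levels {P R : C} (ch : Chain P R) : List (Level P R) := ch.levelsFrom Binder.root

end Chain

/-! ### Rules, transformations, parallel independence -/

/-- A rule `(l : K ⟶ L, r : K ⟶ R)` with `l, r ∈ M` and an application condition in `M`-normal form. -/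
structure Rule (M : MorphismProperty C) where
  L : C
  K : C
  R : C
  l : K ⟶ L
  r : K ⟶ R
  l_mem : M l
  r_mem : M r
  ac : Cond L
  ac_normal : ac.IsMNormal M

variable {M : MorphismProperty C}

/-- An ac-disregarding transformation of `G` via `ρ` at the match `m`: a double pushout from the
rule span `L ⟵ K ⟶ R` to the span `G ⟵ D ⟶ H` of `g` and `h`. (The properties `g, h ∈ M` hold
automatically in an adhesive HLR category.) -/
structure Transformation (ρ : Rule M) (G : C) where
  m : ρ.L ⟶ G
  D : C
  H : C
  k : ρ.K ⟶ D
  n : ρ.R ⟶ H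
  g : D ⟶ G
  h : D ⟶ H
  isPushout_left : IsPushout ρ.l k m g
  isPushout_right : IsPushout ρ.r k n h

/-- The match satisfies the application condition: the transformation is a transformation in the
proper sense. -/
def Transformation.SatisfiesAC {ρ : Rule M} {G : C} (t : Transformation ρ G) : Prop :=
  ρ.ac.Sat M t.m

section Pair

variable {ρ₁ ρ₂ : Rule M} {G : C} (t₁ : Transformation ρ₁ G) (t₂ : Transformation ρ₂ G)

def ParallelIndependent : Prop :=
  ∃ (d₁ : ρ₂.L ⟶ t₁.D) (d₂ : ρ₁.L ⟶ t₂.D),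
    d₁ ≫ t₁.g = t₂.m ∧ d₂ ≫ t₂.g = t₁.m ∧
      ρ₂.ac.Sat M (d₁ ≫ t₁.h) ∧ ρ₁.ac.Sat M (d₂ ≫ t₂.h)

def ParallelDependent : Prop := ¬ ParallelIndependent t₁ t₂

def ParallelIndependentACDisregarding : Prop :=
  ∃ (d₁ : ρ₂.L ⟶ t₁.D) (d₂ : ρ₁.L ⟶ t₂.D), d₁ ≫ t₁.g = t₂.m ∧ d₂ ≫ t₂.g = t₁.m

/-- The condition `ac_G` of the symbolic transformation pair of `(t₁, t₂)`. -/
def symbAC (F : PairFactorization M) : Cond G :=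
  (ρ₁.ac.shift F t₁.m).and (ρ₂.ac.shift F t₂.m)

open Classical in
/-- The condition `ac*_{G,d₁}`: false if `t₁` destroys the match of `t₂`, and otherwise the
left-translation of the application condition of `ρ₂`, shifted to `H₁`. -/
noncomputable def survivesAC (F : PairFactorization M) : Cond G :=
  if h : ∃ d₁ : ρ₂.L ⟶ t₁.D, d₁ ≫ t₁.g = t₂.m then
    (ρ₂.ac.shift F (h.choose ≫ t₁.h)).left t₁.g t₁.h
  else Cond.ff G

/-- The condition `ac*_G` of the symbolic transformation pair of `(t₁, t₂)`. -/
noncomputable def symbConflictAC (F : PairFactorization M) : Cond G :=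
  ((survivesAC t₁ t₂ F).and (survivesAC t₂ t₁ F)).neg

end Pair

section Coproduct

variable [HasBinaryCoproducts C]

lemma isPushout_coprod_inl {A B : C} (f : A ⟶ B) (X : C) :
    IsPushout f coprod.inl coprod.inl (coprod.map f (𝟙 X)) :=
  (IsPushout.of_coprod_inl_with_id f X).flip

lemma isPushout_coprod_inr {A B : C} (f : A ⟶ B) (X : C) :
    IsPushout f coprod.inr coprod.inr (coprod.map (𝟙 X) f) := by
  refine (isPushout_coprod_inl f X).of_iso (Iso.refl _) (Iso.refl _) (coprod.braiding _ _)
    (coprod.braiding _ _) ?_ ?_ ?_ ?_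
  · simp
  · simpa using coprod.inl_desc _ _
  · simpa using coprod.inl_desc _ _
  · simp

/-- The ac-disregarding transformation `L₁ + L₂ ⟹ R₁ + L₂` via `ρ₁` at `L₁ ⟶ L₁ + L₂`. -/
noncomputable def coprodTransformation₁ (ρ₁ ρ₂ : Rule M) :
    Transformation ρ₁ (ρ₁.L ⨿ ρ₂.L) where
  m := coprod.inl
  D := ρ₁.K ⨿ ρ₂.L
  H := ρ₁.R ⨿ ρ₂.L
  k := coprod.inl
  n := coprod.inl
  g := coprod.map ρ₁.l (𝟙 _)
  h := coprod.map ρ₁.r (𝟙 _)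
  isPushout_left := isPushout_coprod_inl _ _
  isPushout_right := isPushout_coprod_inl _ _

/-- The ac-disregarding transformation `L₁ + L₂ ⟹ L₁ + R₂` via `ρ₂` at `L₂ ⟶ L₁ + L₂`. -/
noncomputable def coprodTransformation₂ (ρ₁ ρ₂ : Rule M) :
    Transformation ρ₂ (ρ₁.L ⨿ ρ₂.L) where
  m := coprod.inr
  D := ρ₁.L ⨿ ρ₂.K
  H := ρ₁.L ⨿ ρ₂.R
  k := coprod.inr
  n := coprod.inr
  g := coprod.map (𝟙 _) ρ₂.l
  h := coprod.map (𝟙 _) ρ₂.r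
  isPushout_left := isPushout_coprod_inr _ _
  isPushout_right := isPushout_coprod_inr _ _

/-- The conjunction `ac_{L₁+L₂} ∧ ac*_{L₁+L₂}` of the two conditions of the symbolic initial
conflict of `ρ₁` and `ρ₂`. -/
noncomputable def symbolicInitialConflictAC (F : PairFactorization M) (ρ₁ ρ₂ : Rule M) :
    Cond (ρ₁.L ⨿ ρ₂.L) :=
  (symbAC (coprodTransformation₁ ρ₁ ρ₂) (coprodTransformation₂ ρ₁ ρ₂) F).and
    (symbConflictAC (coprodTransformation₁ ρ₁ ρ₂) (coprodTransformation₂ ρ₁ ρ₂) F)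

end Coproduct

/-! ### Rule overlaps and their embeddings -/

/-- A rule overlap of `ρ₁` and `ρ₂`: a span `(b₁ : A ⟶ P₁, b₂ : A ⟶ P₂)` with morphisms `L₁ ⟶ P₁` and
`L₂ ⟶ P₂`. -/
structure RuleOverlap (ρ₁ ρ₂ : Rule M) where
  A : C
  P₁ : C
  P₂ : C
  b₁ : A ⟶ P₁
  b₂ : A ⟶ P₂
  p₁ : ρ₁.L ⟶ P₁
  p₂ : ρ₂.L ⟶ P₂

namespace RuleOverlap

variable {ρ₁ ρ₂ : Rule M}

/-- The same overlap with the roles of the two rules exchanged. -/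
def swap (ro : RuleOverlap ρ₁ ρ₂) : RuleOverlap ρ₂ ρ₁ :=
  ⟨ro.A, ro.P₂, ro.P₁, ro.b₂, ro.b₁, ro.p₂, ro.p₁⟩

/-- `(q₁, q₂)` is an embedding of `ro` in the (ac-disregarding) transformation pair `(t₁, t₂)`. -/
structure IsEmbedding (ro : RuleOverlap ρ₁ ρ₂) {G : C} (t₁ : Transformation ρ₁ G)
    (t₂ : Transformation ρ₂ G) (q₁ : ro.P₁ ⟶ G) (q₂ : ro.P₂ ⟶ G) : Prop where
  fac₁ : ro.p₁ ≫ q₁ = t₁.m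
  fac₂ : ro.p₂ ≫ q₂ = t₂.m
  isPullback : IsPullback ro.b₁ ro.b₂ q₁ q₂

/-- `ro` embeds in some pair of ac-disregarding transformations that is parallel independent
ac-disregarding. -/
def IsACConflicting (ro : RuleOverlap ρ₁ ρ₂) : Prop :=
  ∃ (G : C) (t₁ : Transformation ρ₁ G) (t₂ : Transformation ρ₂ G),
    ParallelIndependentACDisregarding t₁ t₂ ∧ ∃ q₁ q₂, ro.IsEmbedding t₁ t₂ q₁ q₂

/-- Both `P₁` and `P₂` are the left-hand sides of the rules. -/
def IsPlain (ro : RuleOverlap ρ₁ ρ₂) : Prop :=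
  ∃ (A : C) (b₁ : A ⟶ ρ₁.L) (b₂ : A ⟶ ρ₂.L), ro = ⟨A, ρ₁.L, ρ₂.L, b₁, b₂, 𝟙 _, 𝟙 _⟩

/-- `co` is a composition of the overlaps `ro` and `ro'`. -/
inductive IsComposition (F : PairFactorization M) (ro ro' : RuleOverlap ρ₁ ρ₂) :
    RuleOverlap ρ₁ ρ₂ → Prop
  | mk {Q₁ Q₂ K A : C} (e₁ : ro.P₁ ⟶ Q₁) (e₁' : ro'.P₁ ⟶ Q₁) (e₂ : ro.P₂ ⟶ Q₂)
      (e₂' : ro'.P₂ ⟶ Q₂) (f₁ : Q₁ ⟶ K) (f₂ : Q₂ ⟶ K) (b₁ : A ⟶ Q₁) (b₂ : A ⟶ Q₂)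
      (he₁ : F.E' e₁ e₁') (he₂ : F.E' e₂ e₂') (hf : F.E' f₁ f₂) (hf₁ : M f₁) (hf₂ : M f₂)
      (h₁ : ro.p₁ ≫ e₁ = ro'.p₁ ≫ e₁') (h₂ : ro.p₂ ≫ e₂ = ro'.p₂ ≫ e₂')
      (outer : IsPullback ro.b₁ ro.b₂ (e₁ ≫ f₁) (e₂ ≫ f₂))
      (outer' : IsPullback ro'.b₁ ro'.b₂ (e₁' ≫ f₁) (e₂' ≫ f₂))
      (inner : IsPullback b₁ b₂ f₁ f₂) :
      IsComposition F ro ro' ⟨A, Q₁, Q₂, b₁, b₂, ro.p₁ ≫ e₁, ro.p₂ ≫ e₂⟩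

end RuleOverlap

/-! ### Proto-essences and disabling essences -/

/-- The proto-essence for `(m₁, m₂)` under `l`: `A` is the pullback of `m₁` and `m₂`, `A'` is the
pullback of `a₁ : A ⟶ L` and `l : K ⟶ L`, and the initial pushout over `k : A' ⟶ A` yields the
essence object `E` and `c : E ⟶ A`. The proto-essence is the span `(c ≫ a₁, c ≫ a₂)`. -/
structure ProtoEssence (M : MorphismProperty C) {K L P G : C} (l : K ⟶ L) (m₁ : L ⟶ G)
    (m₂ : P ⟶ G) where
  A : C
  a₁ : A ⟶ L
  a₂ : A ⟶ P
  isPullback : IsPullback a₁ a₂ m₁ m₂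
  A' : C
  k : A' ⟶ A
  k' : A' ⟶ K
  isPullback' : IsPullback k k' a₁ l
  B : C
  E : C
  b : B ⟶ A'
  b' : B ⟶ E
  c : E ⟶ A
  isInitialPushout : IsInitialPushout M k b b' c

/-- The proto-essence is the trivial span `L ← ⊥ → P` (up to isomorphism): its essence object is
initial. -/
def ProtoEssence.IsTrivial {K L P G : C} {l : K ⟶ L} {m₁ : L ⟶ G} {m₂ : P ⟶ G}
    (e : ProtoEssence M l m₁ m₂) : Prop :=
  Nonempty (IsInitial e.E)

/-- `IsSelectedLevel M l eL eP ch s i ℓ`: for the cospan `(eL, eP)` of `L` and the last object of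
the chain `ch`, the proto-essence at level `i` under `l`, where the recursion is started at
level `s`, is the one computed for the object of the level `ℓ`. It is kept as soon as it is not
trivial. -/
inductive IsSelectedLevel (M : MorphismProperty C) {K L P R X : C} (l : K ⟶ L) (eL : L ⟶ X)
    (eP : R ⟶ X) (ch : Chain P R) (s : ℕ) : ℕ → Level P R → Prop
  | start (ℓ : Level P R) : ch.levels[s]? = some ℓ → IsSelectedLevel M l eL eP ch s s ℓ
  | keep (i : ℕ) (ℓ : Level P R) (e : ProtoEssence M l eL (ℓ.toLeaf ≫ eP)) :
      IsSelectedLevel M l eL eP ch s i ℓ → i < ch.length → ¬ e.IsTrivial →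
      IsSelectedLevel M l eL eP ch s (i + 1) ℓ
  | next (i : ℕ) (ℓ ℓ' : Level P R) (e : ProtoEssence M l eL (ℓ.toLeaf ≫ eP)) :
      IsSelectedLevel M l eL eP ch s i ℓ → e.IsTrivial → ch.levels[i + 1]? = some ℓ' →
      IsSelectedLevel M l eL eP ch s (i + 1) ℓ'

/-- The admissible choices of a path `ch` from `L₂` to `Pₙ` and a cospan `(eL, eP) ∈ E'` of `L`
and `Pₙ`: either `Pₙ = L₂` and the path is empty, or `Pₙ` is a leaf of the tree of `ac₂`, the path
leads from the root to this leaf, and `eP` is in `M`. -/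
def IsOverlapWithLeaf (F : PairFactorization M) (ρ₂ : Rule M) {L R X : C} (ch : Chain ρ₂.L R)
    (eL : L ⟶ X) (eP : R ⟶ X) : Prop :=
  F.E' eL eP ∧ (ch.length = 0 ∨ (IsRootLeafPath true ρ₂.ac ch ∧ M eP))

/-- The path `ch` and the cospan `(eL, eP)` are admissible, and the resulting proto-essence at level
`n`, the length of the path, is the one computed for the object of the level `ℓ`. By deletion, `l`
is the left morphism `l₁` of the first rule and `s = 0`; by insertion, `l` is the right morphism
`r₁` and `s = 1`. -/
def IsProtoEssenceAt (F : PairFactorization M) (ρ₂ : Rule M) {K L R X : C} (l : K ⟶ L) (s : ℕ)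
    (ch : Chain ρ₂.L R) (eL : L ⟶ X) (eP : R ⟶ X) (ℓ : Level ρ₂.L R) : Prop :=
  IsOverlapWithLeaf F ρ₂ ch eL eP ∧ IsSelectedLevel M l eL eP ch s ch.length ℓ

/-- For some cospan `(e₁, e₂) ∈ E'` of `P₁` and `P₂`, the overlap `ro` embeds via `(e₁, e₂)` in a
pair of ac-disregarding transformations with the matches `p₁ ≫ e₁` and `p₂ ≫ e₂`. -/
def RuleOverlap.EmbedsMinimally (F : PairFactorization M) {ρ₁ ρ₂ : Rule M}
    (ro : RuleOverlap ρ₁ ρ₂) : Prop :=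
  ∃ (X : C) (e₁ : ro.P₁ ⟶ X) (e₂ : ro.P₂ ⟶ X) (t₁ : Transformation ρ₁ X)
    (t₂ : Transformation ρ₂ X), F.E' e₁ e₂ ∧ ro.IsEmbedding t₁ t₂ e₁ e₂

/-- The disabling essences of `ρ₁` in `ρ₂`, as rule overlaps. -/
inductive DisablingEssence (F : PairFactorization M) (ρ₁ ρ₂ : Rule M) :
    RuleOverlap ρ₁ ρ₂ → Prop
  /-- by deletion: the span `L₁ ← A → Pᵢ` -/
  | deletion {R X : C} (ch : Chain ρ₂.L R) (eL : ρ₁.L ⟶ X) (eP : R ⟶ X) (ℓ : Level ρ₂.L R)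
      (e : ProtoEssence M ρ₁.l eL (ℓ.toLeaf ≫ eP))
      (proto : IsProtoEssenceAt F ρ₂ ρ₁.l 0 ch eL eP ℓ)
      (binder : ℓ.binder = Binder.exist ∨ ℓ.binder = Binder.root)
      (nontrivial : ¬ e.IsTrivial)
      (embeds : RuleOverlap.EmbedsMinimally F (ρ₁ := ρ₁) (ρ₂ := ρ₂)
        ⟨e.A, ρ₁.L, ℓ.obj, e.a₁, e.a₂, 𝟙 _, ℓ.fromRoot⟩) :
      DisablingEssence F ρ₁ ρ₂ ⟨e.A, ρ₁.L, ℓ.obj, e.a₁, e.a₂, 𝟙 _, ℓ.fromRoot⟩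
  /-- by insertion: the span `R₁ ← A → Pᵢ` is shifted over `ρ₁` to `L₁ ← A' → Pᵢ'`, where
  `A' ⟶ Pᵢ' ⟶ Pᵢ` is a pushout complement of `A' ⟶ A ⟶ Pᵢ` -/
  | insertion {R X : C} (ch : Chain ρ₂.L R) (eR : ρ₁.R ⟶ X) (eP : R ⟶ X) (ℓ : Level ρ₂.L R)
      (e : ProtoEssence M ρ₁.r eR (ℓ.toLeaf ≫ eP))
      (proto : IsProtoEssenceAt F ρ₂ ρ₁.r 1 ch eR eP ℓ)
      (binder : ℓ.binder = Binder.univ)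
      (nontrivial : ¬ e.IsTrivial)
      (P' : C) (a' : e.A' ⟶ P') (p' : P' ⟶ ℓ.obj) (complement : IsPushout e.k a' e.a₂ p')
      (q : ρ₂.L ⟶ P') (hq : q ≫ p' = ℓ.fromRoot)
      (embeds : RuleOverlap.EmbedsMinimally F (ρ₁ := ρ₁) (ρ₂ := ρ₂)
        ⟨e.A', ρ₁.L, P', e.k' ≫ ρ₁.l, a', 𝟙 _, q⟩) :
      DisablingEssence F ρ₁ ρ₂ ⟨e.A', ρ₁.L, P', e.k' ≫ ρ₁.l, a', 𝟙 _, q⟩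

/-! ### Conflict essences and symbolic conflict essences -/

/-- The conflict essences of `ρ₁` and `ρ₂`. -/
inductive ConflictEssence (F : PairFactorization M) (ρ₁ ρ₂ : Rule M) :
    RuleOverlap ρ₁ ρ₂ → Prop
  | disabling (ro : RuleOverlap ρ₁ ρ₂) :
      DisablingEssence F ρ₁ ρ₂ ro ∨ DisablingEssence F ρ₂ ρ₁ ro.swap →
      ro.IsACConflicting ∨ ro.IsPlain → ConflictEssence F ρ₁ ρ₂ ro
  | composition (ro ro' co : RuleOverlap ρ₁ ρ₂) :
      ConflictEssence F ρ₁ ρ₂ ro → ConflictEssence F ρ₁ ρ₂ ro' →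
      (ro.IsACConflicting ↔ ro'.IsACConflicting) → ro.IsComposition F ro' co →
      ConflictEssence F ρ₁ ρ₂ co

/-- Cospan conditions over two objects. -/
inductive CospanCond (P P' : C) : Type (max (u + 1) (v + 1)) where
  | tt : CospanCond P P'
  | neg (c : CospanCond P P') : CospanCond P P'
  | conj (I : Type (max u v)) (c : I → CospanCond P P') : CospanCond P P'
  | ex {Q : C} (p : P ⟶ Q) (p' : P' ⟶ Q) (d : Cond Q) : CospanCond P P'

/-- Satisfaction of a cospan condition by a pair of morphisms. The mediating morphism `Q ⟶ G` need
not be in `M`. -/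
def CospanCond.Sat (M : MorphismProperty C) {P P' G : C} (q : P ⟶ G) (q' : P' ⟶ G) :
    CospanCond P P' → Prop
  | tt => True
  | neg c => ¬ Sat M q q' c
  | conj _ c => ∀ i, Sat M q q' (c i)
  | ex (Q := Q) p p' d => ∃ f : Q ⟶ G, d.Sat M f ∧ p ≫ f = q ∧ p' ≫ f = q'

/-- `(ce, ac)` is a symbolic conflict essence of `ρ₁` and `ρ₂`. If `ce` is ac-conflicting, then
`ac = ∃ (P₁ ⟶ D ⟵ P₂, Shift (m*, ac_{L₁+L₂} ∧ ac*_{L₁+L₂}))`, where `D` is the pushout of the span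
`ce` and `m* : L₁ + L₂ ⟶ D` is the induced morphism; otherwise `ac` is `true`. -/
def IsSymbolicConflictEssence [HasBinaryCoproducts C] (F : PairFactorization M)
    (ρ₁ ρ₂ : Rule M) (ce : RuleOverlap ρ₁ ρ₂) (ac : CospanCond ce.P₁ ce.P₂) : Prop :=
  ConflictEssence F ρ₁ ρ₂ ce ∧
    (ce.IsACConflicting →
      ∃ (D : C) (d₁ : ce.P₁ ⟶ D) (d₂ : ce.P₂ ⟶ D), IsPushout ce.b₁ ce.b₂ d₁ d₂ ∧
        ac = CospanCond.ex d₁ d₂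
          ((symbolicInitialConflictAC F ρ₁ ρ₂).shift F
            (coprod.desc (ce.p₁ ≫ d₁) (ce.p₂ ≫ d₂)))) ∧
    (¬ ce.IsACConflicting → ac = CospanCond.tt)

/-- The overlap with cospan condition `(ce, ac)` is embeddable in `(t₁, t₂)`: some embedding of
`ce` satisfies `ac`. -/
def IsSymbolicallyEmbeddable {ρ₁ ρ₂ : Rule M} (ce : RuleOverlap ρ₁ ρ₂)
    (ac : CospanCond ce.P₁ ce.P₂) {G : C} (t₁ : Transformation ρ₁ G)
    (t₂ : Transformation ρ₂ G) : Prop :=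
  ∃ (q₁ : ce.P₁ ⟶ G) (q₂ : ce.P₂ ⟶ G), ce.IsEmbedding t₁ t₂ q₁ q₂ ∧ ac.Sat M q₁ q₂

end ConflictEssences

/-!
The essential point is a dichotomy for proto-essences: by stability of pushouts along
`M`-morphisms, `ProtoEssence M l m q` is trivial iff `q` factors through the context of the
pushout of `l` along `m` (`ProtoEssence.isTrivial_iff_exists_fac`).

Suppose the pair is parallel dependent. If `t₁` destroys the match of `t₂`, the pullback of the
matches is a plain disabling essence. It is not ac-conflicting, because its nontriviality, which
is intrinsic to the overlap, excludes factorizations in every other embedding. Otherwise the match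
of `t₂` lies in the context `D₁`, which is embedded in both `G` and `H₁`, and the application
condition of one of the rules, say `ρ₂`, holds in `G` but not after the transformation. Descending
in this condition while all objects met are mapped into `D₁`, one finds an existentially bound
object in `G`, or a universally bound one in `H₁`, that does not lie in `D₁` (`exists_escape`).
This object yields a disabling essence by deletion or by insertion. The path is completed to a
leaf by a pushout; the codomain of the cospan over the leaf need not embed in `G` or `H₁`. The
essence embeds in the given pair, so it is ac-conflicting by definition, and its cospan condition
holds. In particular compositions of conflict essences are not needed to detect a conflict.

For the converse, an overlap that embeds in a parallel independent pair is ac-conflicting, and its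
cospan condition says that the pair is parallel dependent (`RuleOverlap.IsEmbedding.sat_ex_iff`);
this rests on the correctness of shifting and left-translation (`Cond.sat_shift`,
`Cond.sat_left`).
-/

namespace ConflictEssences

variable {C : Type u} [Category.{v} C] {M : MorphismProperty C}

/-! ### Pushouts along `M`-morphisms -/

namespace IsAdhesiveHLR

lemma mem_id (hM : IsAdhesiveHLR M) (X : C) : M (𝟙 X) :=
  haveI := hM.multiplicative
  M.id_mem X

lemma mem_comp (hM : IsAdhesiveHLR M) {X Y Z : C} {f : X ⟶ Y} {g : Y ⟶ Z} (hf : M f)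
    (hg : M g) : M (f ≫ g) :=
  haveI := hM.multiplicative
  M.comp_mem _ _ hf hg

lemma mem_fst_of_isPullback (hM : IsAdhesiveHLR M) {P X Y Z : C} {fst : P ⟶ X}
    {snd : P ⟶ Y} {f : X ⟶ Z} {g : Y ⟶ Z} (h : IsPullback fst snd f g) (hg : M g) : M fst :=
  haveI := hM.stableUnderBaseChange
  M.of_isPullback h.flip hg

lemma mem_inr_of_isPushout (hM : IsAdhesiveHLR M) {X Y Z W : C} {f : X ⟶ Y} {g : X ⟶ Z}
    {inl : Y ⟶ W} {inr : Z ⟶ W} (h : IsPushout f g inl inr) (hf : M f) : M inr :=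
  haveI := hM.stableUnderCobaseChange
  M.of_isPushout h.flip hf

lemma isPullback_of_isPushout (hM : IsAdhesiveHLR M) {X Y Z W : C} {f : X ⟶ Y} {g : X ⟶ Z}
    {inl : Y ⟶ W} {inr : Z ⟶ W} (h : IsPushout f g inl inr) (hf : M f) : IsPullback f g inl inr :=
  haveI := hM.mono f hf
  (hM.vanKampen h hf).isPullback_of_mono_left

end IsAdhesiveHLR

lemma isPullback_id_of_fac {X Y Z : C} {f : X ⟶ Y} {g : Y ⟶ Z} {h : X ⟶ Z} [Mono g]
    (w : f ≫ g = h) : IsPullback f (𝟙 X) g h := by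
  refine IsPullback.of_isLimit' ⟨by simpa⟩
    (PullbackCone.IsLimit.mk _ (fun s => s.snd) (fun s => ?_) (fun s => ?_) ?_)
  · rw [← cancel_mono g, Category.assoc, w, s.condition]
  · simp
  · intro s m _ hm
    simpa using hm

/-- A pullback square over mono legs does not depend on the object into which both legs are
embedded. -/
lemma isPullback_of_comp_mono {A X Y Z Z' W : C} {a : A ⟶ X} {b : A ⟶ Y} {f : X ⟶ Z}
    {g : Y ⟶ Z} {f' : X ⟶ Z'} {g' : Y ⟶ Z'} {i : Z ⟶ W} {j : Z' ⟶ W} [Mono i] [Mono j]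
    (h : IsPullback a b f g) (hf : f ≫ i = f' ≫ j) (hg : g ≫ i = g' ≫ j) :
    IsPullback a b f' g' := by
  refine IsPullback.of_isLimit' ⟨?_⟩ (PullbackCone.IsLimit.mk _
    (fun s => h.lift s.fst s.snd ?_) ?_ ?_ ?_)
  · rw [← cancel_mono j, Category.assoc, Category.assoc, ← hf, ← hg, ← Category.assoc, h.w,
      Category.assoc]
  · rw [← cancel_mono i, Category.assoc, Category.assoc, hf, hg, ← Category.assoc, s.condition,
      Category.assoc]
  · intro s
    simp
  · intro s
    simp
  · intro s m h₁ h₂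
    apply h.hom_ext <;> simp [h₁, h₂]

/-- Pushouts along `M`-morphisms restrict along a mono `q : Q ⟶ H` through which one leg of the
pushout factors. -/
lemma IsAdhesiveHLR.isPushout_restrict (hM : IsAdhesiveHLR M) {K R D H Q Z : C} {r : K ⟶ R}
    {k : K ⟶ D} {n : R ⟶ H} {h : D ⟶ H} (po : IsPushout r k n h) (hr : M r) {a : R ⟶ Q}
    {q : Q ⟶ H} [Mono q] (hq : a ≫ q = n) {z : Z ⟶ D} {r' : Z ⟶ Q} (pb : IsPullback r' z q h)
    {kZ : K ⟶ Z} (hz : kZ ≫ z = k) (hr' : kZ ≫ r' = r ≫ a) : IsPushout r kZ a r' := by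
  have hz_mono : Mono z := ⟨fun x y hxy => by
    apply pb.hom_ext _ hxy
    rw [← cancel_mono q, Category.assoc, Category.assoc, pb.w, reassoc_of% hxy]⟩
  exact (hM.vanKampen po hr r kZ a r' (𝟙 K) (𝟙 R) z q (IsPullback.of_vert_isIso ⟨by simp⟩)
    (isPullback_id_of_fac hz) ⟨by simpa⟩ pb.toCommSq ⟨hr'.symm⟩).mpr ⟨isPullback_id_of_fac hq, pb⟩

/-- A pushout along an `M`-morphism restricts along every `M`-morphism through which one leg
factors: the restricted complement is the pullback of the other leg. -/
lemma IsAdhesiveHLR.exists_restrict [HasPullbacks C] (hM : IsAdhesiveHLR M) {K R D H Q : C}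
    {r : K ⟶ R} {k : K ⟶ D} {n : R ⟶ H} {h : D ⟶ H} (po : IsPushout r k n h) (hr : M r) {a : R ⟶ Q}
    {q : Q ⟶ H} (mq : M q) (hq : a ≫ q = n) :
    ∃ (Z : C) (kZ : K ⟶ Z) (z : Z ⟶ D) (r' : Z ⟶ Q), M z ∧ kZ ≫ z = k ∧
      IsPullback r' z q h ∧ IsPushout r kZ a r' := by
  have := hM.mono q mq
  have pb := IsPullback.of_hasPullback q h
  have w : (r ≫ a) ≫ q = k ≫ h := by rw [Category.assoc, hq, po.w]
  exact ⟨_, pb.lift (r ≫ a) k w, _, _, hM.mem_fst_of_isPullback pb.flip mq,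
    pb.lift_snd _ _ w, pb, hM.isPushout_restrict po hr hq pb (pb.lift_snd _ _ w)
      (pb.lift_fst _ _ w)⟩

/-- Pushout complements of `M`-morphisms are unique up to isomorphism. -/
lemma IsAdhesiveHLR.exists_iso_complement [HasPullbacks C] (hM : IsAdhesiveHLR M) {K R Q Z Z' : C}
    {r : K ⟶ R} (hr : M r) {a : R ⟶ Q} {k : K ⟶ Z} {c : Z ⟶ Q} {k' : K ⟶ Z'} {c' : Z' ⟶ Q}
    (po : IsPushout r k a c) (po' : IsPushout r k' a c') :
    ∃ i : Z ≅ Z', k ≫ i.hom = k' ∧ i.hom ≫ c' = c := by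
  -- Pulling the first complement back along the second one yields a pushout of an identity.
  have key {Z Z' : C} {k : K ⟶ Z} {c : Z ⟶ Q} {k' : K ⟶ Z'} {c' : Z' ⟶ Q}
      (po : IsPushout r k a c) (po' : IsPushout r k' a c') :
      ∃ j : Z' ⟶ Z, j ≫ c = c' := by
    have := hM.mono r hr
    have := hM.mono c (hM.mem_inr_of_isPushout po hr)
    have := hM.mono c' (hM.mem_inr_of_isPushout po' hr)
    have pb := IsPullback.of_hasPullback c' c
    have w : k' ≫ c' = k ≫ c := by rw [← po.w, ← po'.w]
    have top : IsPushout (𝟙 K) (pb.lift k' k w) k' (pullback.fst c' c) := by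
      refine (hM.vanKampen po hr (𝟙 K) _ k' _ (𝟙 K) r (pullback.snd c' c) c'
        (IsKernelPair.id_of_mono r) ?_ ⟨po'.w.symm⟩ pb.toCommSq ⟨by simp⟩).mpr
        ⟨(hM.isPullback_of_isPushout po' hr).flip, pb⟩
      exact isPullback_id_of_fac (pb.lift_snd _ _ w)
    have := top.isIso_inr_of_isIso
    exact ⟨inv (pullback.fst c' c) ≫ pullback.snd c' c, by
      rw [Category.assoc, ← pb.w, IsIso.inv_hom_id_assoc]⟩
  obtain ⟨j, hj⟩ := key po po'
  obtain ⟨i, hi⟩ := key po' po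
  have := hM.mono c (hM.mem_inr_of_isPushout po hr)
  have := hM.mono c' (hM.mem_inr_of_isPushout po' hr)
  refine ⟨⟨i, j, ?_, ?_⟩, ?_, hi⟩
  · rw [← cancel_mono c, Category.assoc, hj, hi, Category.id_comp]
  · rw [← cancel_mono c', Category.assoc, hi, hj, Category.id_comp]
  · rw [← cancel_mono c', Category.assoc, hi, ← po.w, ← po'.w]

/-- An extension of two pushouts that share the morphism `k` to larger objects: if `q : Q ⟶ H` is an
`M`-morphism, the pushout of `r` and `k` decomposes at `Q`, and so does, at the pushout `Y` of `l`
and `kZ`, the pushout of `l` and `k`. -/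
lemma IsAdhesiveHLR.exists_extension [HasPullbacks C] (hM : IsAdhesiveHLR M)
    {L K R D G H Z Y Q : C} {l : K ⟶ L} {r : K ⟶ R} (hr : M r) {m : L ⟶ G} {k : K ⟶ D}
    {g : D ⟶ G} {n : R ⟶ H} {h : D ⟶ H} (pl : IsPushout l k m g) (pr : IsPushout r k n h)
    {kZ : K ⟶ Z} {b : L ⟶ Y} {l' : Z ⟶ Y} {a : R ⟶ Q} {r' : Z ⟶ Q} (sl : IsPushout l kZ b l')
    (sr : IsPushout r kZ a r') {q : Q ⟶ H} (mq : M q) (hq : a ≫ q = n) :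
    ∃ (z : Z ⟶ D) (q' : Y ⟶ G), M q' ∧ b ≫ q' = m ∧ IsPushout l' z q' g ∧
      IsPushout r' z q h := by
  obtain ⟨Z', kZ', z, r'', mz, hz, pb, po⟩ := hM.exists_restrict pr hr mq hq
  obtain ⟨i, hi, hi'⟩ := hM.exists_iso_complement hr sr po
  have := hM.stableUnderBaseChange
  have miz : M (i.hom ≫ z) := (M.cancel_left_of_respectsIso i.hom z).mpr mz
  have hk : k = kZ ≫ i.hom ≫ z := by rw [reassoc_of% hi, hz]
  subst hk hq
  have pq := pl.of_top' sl
  exact ⟨i.hom ≫ z, _, hM.mem_inr_of_isPushout pq.flip miz, sl.inl_desc _ _ _, pq,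
    pr.of_top (by rw [← hi', Category.assoc, pb.w, Category.assoc]) sr⟩

/-! ### Satisfaction of shifted and left-translated conditions -/

namespace Cond

@[simp]
lemma sat_and {P G : C} (q : P ⟶ G) (c d : Cond P) :
    (c.and d).Sat M q ↔ c.Sat M q ∧ d.Sat M q := by
  simp only [Cond.and, Sat]
  exact ⟨fun h => ⟨h ⟨true⟩, h ⟨false⟩⟩, by rintro ⟨h, h'⟩ ⟨_ | _⟩ <;> assumption⟩

@[simp]
lemma sat_disj {P G : C} (q : P ⟶ G) (I : Type (max u v)) (c : I → Cond P) :
    (disj I c).Sat M q ↔ ∃ i, (c i).Sat M q := by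
  simp [disj, Sat]

/-- Shifting transports satisfaction along precomposition: the index cospan for a witness is its
`E'`-`M` factorization, whose second leg is in `M` by decomposition. -/
lemma sat_shift (hM : IsAdhesiveHLR M) (F : PairFactorization M) {P P' G : C} (c : Cond P)
    (b : P ⟶ P') (q : P' ⟶ G) : (c.shift F b).Sat M q ↔ c.Sat M (b ≫ q) := by
  induction c generalizing P' with
  | tt => simp [shift, Sat]
  | neg c ih => simp [shift, Sat, ih]
  | conj I c ih => simp [shift, Sat, ih]
  | ex p d ih =>
    simp only [shift, sat_disj, Sat, ih]
    constructor
    · rintro ⟨i, q', hq', rfl, h⟩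
      exact ⟨i.b' ≫ q', hM.mem_comp i.mem_M hq', by rw [← Category.assoc, ← i.comm,
        Category.assoc], h⟩
    · rintro ⟨q', hq', hc, h⟩
      obtain ⟨X, e, e', m, he, hm, rfl, rfl⟩ := F.exists_fac q q'
      have := hM.mono m hm
      exact ⟨⟨X, e, e', he, hM.decomposition _ _ hq' hm, by
        rw [← cancel_mono m, Category.assoc, Category.assoc, hc]⟩, m, hm, rfl, h⟩

/-- Left-translation transports satisfaction along a double pushout. The pushout complement chosen
in the definition does not matter, by uniqueness of pushout complements. -/
lemma sat_left [HasPullbacks C] (hM : IsAdhesiveHLR M) {R : C} (c : Cond R) :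
    ∀ {L K D G H : C} {l : K ⟶ L} {r : K ⟶ R} (_ : M l) (_ : M r) {m : L ⟶ G}
    {k : K ⟶ D} {g : D ⟶ G} {n : R ⟶ H} {h : D ⟶ H}
    (_ : IsPushout l k m g) (_ : IsPushout r k n h), (c.left l r).Sat M m ↔ c.Sat M n := by
  induction c with
  | tt => intros; simp [left, Sat]
  | neg c ih =>
    intro L K D G H l r hl hr m k g n h pl pr
    simp [left, Sat, ih hl hr pl pr]
  | conj I c ih =>
    intro L K D G H l r hl hr m k g n h pl pr
    simp [left, Sat, ih _ hl hr pl pr]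
  | @ex R Q p d ih =>
    intro L K D G H l r hl hr m k g n h pl pr
    by_cases hs : Nonempty (LeftStep l r p)
    · simp only [left, dif_pos hs, Sat]
      generalize hs.some = s
      have hs_l := hM.mem_inr_of_isPushout s.isPushout_left hl
      have hs_r := hM.mem_inr_of_isPushout s.isPushout_right hr
      constructor
      · rintro ⟨q, mq, hq, hsat⟩
        obtain ⟨z, q', mq', hq', pr', pl'⟩ :=
          hM.exists_extension hl pr pl s.isPushout_right s.isPushout_left mq hq
        exact ⟨q', mq', hq', (ih hs_l hs_r pl' pr').mp hsat⟩
      · rintro ⟨q, mq, hq, hsat⟩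
        obtain ⟨z, q', mq', hq', pl', pr'⟩ :=
          hM.exists_extension hr pl pr s.isPushout_left s.isPushout_right mq hq
        exact ⟨q', mq', hq', (ih hs_l hs_r pl' pr').mpr hsat⟩
    · simp only [left, dif_neg hs, ff, Sat, not_true_eq_false, false_iff]
      rintro ⟨q, mq, hq, hsat⟩
      obtain ⟨Z, kZ, z, r', mz, hz, pb, po⟩ := hM.exists_restrict pr hr mq hq
      have := hM.hasPushout l kZ hl
      exact hs ⟨⟨_, kZ, r', _, _, _, po, IsPushout.of_hasPushout l kZ⟩⟩

end Cond

/-! ### The condition of the symbolic initial conflict -/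

section Symbolic

variable {ρ₁ ρ₂ : Rule M} {G : C}

lemma Transformation.mem_g (hM : IsAdhesiveHLR M) {ρ : Rule M} (t : Transformation ρ G) : M t.g :=
  hM.mem_inr_of_isPushout t.isPushout_left ρ.l_mem

lemma Transformation.mem_h (hM : IsAdhesiveHLR M) {ρ : Rule M} (t : Transformation ρ G) : M t.h :=
  hM.mem_inr_of_isPushout t.isPushout_right ρ.r_mem

lemma survivesAC_eq_of_fac (hM : IsAdhesiveHLR M) (F : PairFactorization M)
    (s₁ : Transformation ρ₁ G) (s₂ : Transformation ρ₂ G) {d : ρ₂.L ⟶ s₁.D}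
    (hd : d ≫ s₁.g = s₂.m) : survivesAC s₁ s₂ F = (ρ₂.ac.shift F (d ≫ s₁.h)).left s₁.g s₁.h := by
  have h : ∃ d : ρ₂.L ⟶ s₁.D, d ≫ s₁.g = s₂.m := ⟨d, hd⟩
  have := hM.mono _ (s₁.mem_g hM)
  have hc : h.choose = d := by rw [← cancel_mono s₁.g, h.choose_spec, hd]
  rw [survivesAC, dif_pos h, hc]

variable [HasBinaryCoproducts C]

/-- A pushout of `l`, applied on one summand of a coproduct whose other summand is mapped into the
context. -/
lemma isPushout_coprodMap_desc {K L X D G : C} {l : K ⟶ L} {m : L ⟶ G} {k : K ⟶ D}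
    {g : D ⟶ G} (po : IsPushout l k m g) {d : X ⟶ D} {m' : X ⟶ G} (hd : d ≫ g = m') :
    IsPushout (coprod.map l (𝟙 X)) (coprod.desc k d) (coprod.desc m m') g := by
  subst hd
  exact IsPushout.of_top (v₁₁ := coprod.inl) (v₁₂ := coprod.inl)
    (by rwa [coprod.inl_desc, coprod.inl_desc]) (by ext <;> simp [po.w]) (isPushout_coprod_inl l X)

lemma isPushout_coprodMap_desc' {K L X D G : C} {l : K ⟶ L} {m : L ⟶ G} {k : K ⟶ D}
    {g : D ⟶ G} (po : IsPushout l k m g) {d : X ⟶ D} {m' : X ⟶ G} (hd : d ≫ g = m') :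
    IsPushout (coprod.map (𝟙 X) l) (coprod.desc d k) (coprod.desc m' m) g := by
  subst hd
  exact IsPushout.of_top (v₁₁ := coprod.inr) (v₁₂ := coprod.inr)
    (by rwa [coprod.inr_desc, coprod.inr_desc]) (by ext <;> simp [po.w]) (isPushout_coprod_inr l X)

/-- If `d` witnesses that `t₁` preserves the match of `t₂`, then `t₁` is also an application of the
rule `L₁ + L₂ ← K₁ + L₂ → R₁ + L₂`, along which the condition is translated. -/
lemma sat_survivesAC_coprod₁ [HasPullbacks C] (hM : IsAdhesiveHLR M) (F : PairFactorization M)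
    (t₁ : Transformation ρ₁ G) (t₂ : Transformation ρ₂ G) {d : ρ₂.L ⟶ t₁.D}
    (hd : d ≫ t₁.g = t₂.m) :
    (survivesAC (coprodTransformation₁ ρ₁ ρ₂) (coprodTransformation₂ ρ₁ ρ₂) F).Sat M
      (coprod.desc t₁.m t₂.m) ↔ ρ₂.ac.Sat M (d ≫ t₁.h) := by
  have hd' : (coprod.inr ≫ coprod.map ρ₁.r (𝟙 ρ₂.L)) ≫ coprod.desc t₁.n (d ≫ t₁.h) = d ≫ t₁.h := by
    simp [coprod.inr_desc]
  rw [survivesAC_eq_of_fac hM F (coprodTransformation₁ ρ₁ ρ₂) (coprodTransformation₂ ρ₁ ρ₂)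
      (d := coprod.inr) (by simp [coprodTransformation₁, coprodTransformation₂])]
  refine (Cond.sat_left hM _ (Transformation.mem_g hM _) (Transformation.mem_h hM _)
    (isPushout_coprodMap_desc t₁.isPushout_left hd)
    (isPushout_coprodMap_desc t₁.isPushout_right rfl)).trans ((Cond.sat_shift hM F _ _ _).trans ?_)
  exact iff_of_eq (congrArg (fun q => ρ₂.ac.Sat M q) hd')

lemma sat_survivesAC_coprod₂ [HasPullbacks C] (hM : IsAdhesiveHLR M) (F : PairFactorization M)
    (t₁ : Transformation ρ₁ G) (t₂ : Transformation ρ₂ G) {d : ρ₁.L ⟶ t₂.D}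
    (hd : d ≫ t₂.g = t₁.m) :
    (survivesAC (coprodTransformation₂ ρ₁ ρ₂) (coprodTransformation₁ ρ₁ ρ₂) F).Sat M
      (coprod.desc t₁.m t₂.m) ↔ ρ₁.ac.Sat M (d ≫ t₂.h) := by
  have hd' : (coprod.inl ≫ coprod.map (𝟙 ρ₁.L) ρ₂.r) ≫ coprod.desc (d ≫ t₂.h) t₂.n = d ≫ t₂.h := by
    simp [coprod.inl_desc]
  rw [survivesAC_eq_of_fac hM F (coprodTransformation₂ ρ₁ ρ₂) (coprodTransformation₁ ρ₁ ρ₂)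
      (d := coprod.inl) (by simp [coprodTransformation₁, coprodTransformation₂])]
  refine (Cond.sat_left hM _ (Transformation.mem_g hM _) (Transformation.mem_h hM _)
    (isPushout_coprodMap_desc' t₂.isPushout_left hd)
    (isPushout_coprodMap_desc' t₂.isPushout_right rfl)).trans ((Cond.sat_shift hM F _ _ _).trans ?_)
  exact iff_of_eq (congrArg (fun q => ρ₁.ac.Sat M q) hd')

/-- On pairs that are parallel independent ac-disregarding, the condition of the symbolic initial
conflict expresses that the pair consists of transformations and is parallel dependent. -/
lemma sat_symbolicInitialConflictAC [HasPullbacks C] (hM : IsAdhesiveHLR M)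
    (F : PairFactorization M) (t₁ : Transformation ρ₁ G) (t₂ : Transformation ρ₂ G)
    (hind : ParallelIndependentACDisregarding t₁ t₂) :
    (symbolicInitialConflictAC F ρ₁ ρ₂).Sat M (coprod.desc t₁.m t₂.m) ↔
      (t₁.SatisfiesAC ∧ t₂.SatisfiesAC) ∧ ParallelDependent t₁ t₂ := by
  obtain ⟨d₁, d₂, hd₁, hd₂⟩ := hind
  have := hM.mono _ (t₁.mem_g hM)
  have := hM.mono _ (t₂.mem_g hM)
  have hdep : ParallelDependent t₁ t₂ ↔
      ¬ (ρ₂.ac.Sat M (d₁ ≫ t₁.h) ∧ ρ₁.ac.Sat M (d₂ ≫ t₂.h)) := by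
    refine not_congr ⟨?_, fun h => ⟨d₁, d₂, hd₁, hd₂, h⟩⟩
    rintro ⟨d₁', d₂', hd₁', hd₂', h⟩
    obtain rfl : d₁' = d₁ := by rw [← cancel_mono t₁.g, hd₁, hd₁']
    obtain rfl : d₂' = d₂ := by rw [← cancel_mono t₂.g, hd₂, hd₂']
    exact h
  have hneg {P : C} (q : P ⟶ G) (c : Cond P) : c.neg.Sat M q ↔ ¬ c.Sat M q := by simp [Cond.Sat]
  rw [hdep, symbolicInitialConflictAC, symbAC, symbConflictAC, Cond.sat_and, Cond.sat_and, hneg,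
    Cond.sat_and, sat_survivesAC_coprod₁ hM F t₁ t₂ hd₁, sat_survivesAC_coprod₂ hM F t₁ t₂ hd₂,
    Cond.sat_shift hM, Cond.sat_shift hM]
  simp only [coprodTransformation₁, coprodTransformation₂, Transformation.SatisfiesAC,
    coprod.inl_desc, coprod.inr_desc]

end Symbolic

/-! ### Triviality of proto-essences -/

section ProtoEssence

variable {K L P D G X : C} {l : K ⟶ L}

lemma exists_protoEssence [HasPullbacks C] (hM : IsAdhesiveHLR M) (hIPO : HasInitialPushouts M)
    (hl : M l) (m₁ : L ⟶ G) (m₂ : P ⟶ G) : Nonempty (ProtoEssence M l m₁ m₂) := by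
  have pb := IsPullback.of_hasPullback (pullback.fst m₁ m₂) l
  obtain ⟨B, E, b, b', c, h⟩ := hIPO _ (hM.mem_fst_of_isPullback pb hl)
  exact ⟨⟨_, _, _, IsPullback.of_hasPullback m₁ m₂, _, _, _, pb, _, _, _, _, _, h⟩⟩

namespace ProtoEssence

variable {m₁ : L ⟶ X} {m₂ : P ⟶ X}

/-- The essence object is initial iff `k : A' ⟶ A` is an isomorphism: over an isomorphism the square
on `⊥` is a pushout through which the initial one factors. -/
lemma isTrivial_iff_isIso (hM : IsAdhesiveHLR M) (hInit : HasMInitial M) (hl : M l)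
    (e : ProtoEssence M l m₁ m₂) : e.IsTrivial ↔ IsIso e.k := by
  have hk : M e.k := hM.mem_fst_of_isPullback e.isPullback' hl
  constructor
  · rintro ⟨hE⟩
    have pb := hM.isPullback_of_isPushout e.isInitialPushout.isPushout e.isInitialPushout.mem_left
    have := hM.mono _ (hM.mem_fst_of_isPullback pb.flip hk)
    have hs : hE.to e.B ≫ e.b' = 𝟙 _ := hE.hom_ext _ _
    have : IsIso e.b' := ⟨hE.to e.B, by
      rw [← cancel_mono e.b', Category.assoc, hs, Category.comp_id, Category.id_comp], hs⟩
    exact e.isInitialPushout.isPushout.isIso_inl_of_isIso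
  · intro hiso
    obtain ⟨I, hI, hIM⟩ := hInit
    -- The square with both objects on the left initial is a pushout over the isomorphism `e.k`.
    have po : IsPushout (hI.to e.A') (𝟙 I) e.k (hI.to e.A) :=
      IsPushout.of_vert_isIso ⟨hI.hom_ext _ _⟩
    obtain ⟨⟨p, p'⟩, ⟨_, _, _, hp', _⟩, _⟩ :=
      e.isInitialPushout.initial _ _ _ po (hIM _) (hIM _)
    have := hM.mono _ hp'
    have hs : hI.to e.E ≫ p' = 𝟙 _ := hI.hom_ext _ _
    exact ⟨hI.ofIso ⟨hI.to e.E, p', hs, by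
      rw [← cancel_mono p', Category.assoc, hs, Category.comp_id, Category.id_comp]⟩⟩

/-- If `A` is a pullback of `q : P ⟶ G` and the leg `m : L ⟶ G` of a pushout of `l` and `k₀`, then
the whole pushout pulls back along `q`, with `A'` over `K`. -/
lemma exists_isPushout (hM : IsAdhesiveHLR M) (hl : M l) (e : ProtoEssence M l m₁ m₂)
    {k₀ : K ⟶ D} {m : L ⟶ G} {g : D ⟶ G} (po : IsPushout l k₀ m g) {q : P ⟶ G}
    (pb : IsPullback e.a₁ e.a₂ m q) {P' : C} {x : P' ⟶ P} {y : P' ⟶ D}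
    (pq : IsPullback x y q g) :
    ∃ a' : e.A' ⟶ P', IsPushout e.k a' e.a₂ x ∧ IsPullback a' e.k' y k₀ := by
  have w : (e.k ≫ e.a₂) ≫ q = (e.k' ≫ k₀) ≫ g := by
    rw [Category.assoc, ← pb.w, reassoc_of% e.isPullback'.w, po.w, Category.assoc]
  have pa : IsPullback (pq.lift _ _ w) e.k' y k₀ := by
    refine IsPullback.of_right ?_ (pq.lift_snd _ _ w) pq
    rw [pq.lift_fst, ← po.w]
    exact e.isPullback'.paste_horiz pb.flip
  exact ⟨pq.lift _ _ w, (hM.vanKampen po hl _ _ _ _ e.k' e.a₁ y q e.isPullback' pa pb.flip.toCommSq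
    pq.toCommSq ⟨(pq.lift_fst _ _ w).symm⟩).mpr ⟨pb.flip, pq⟩, pa⟩

/-- A proto-essence is trivial iff the second morphism factors through the context `D`, i.e. it
avoids the part of `L` outside `K`. -/
lemma isTrivial_iff_exists_fac [HasPullbacks C] (hM : IsAdhesiveHLR M) (hInit : HasMInitial M)
    (hl : M l) (e : ProtoEssence M l m₁ m₂) {k₀ : K ⟶ D} {m : L ⟶ G} {g : D ⟶ G}
    (po : IsPushout l k₀ m g) {q : P ⟶ G} (pb : IsPullback e.a₁ e.a₂ m q) :
    e.IsTrivial ↔ ∃ d : P ⟶ D, d ≫ g = q := by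
  rw [e.isTrivial_iff_isIso hM hInit hl]
  constructor
  · intro hiso
    have pq := IsPullback.of_hasPullback q g
    obtain ⟨a', po', -⟩ := e.exists_isPushout hM hl po pb pq
    have := po'.isIso_inr_of_isIso
    exact ⟨inv (pullback.fst q g) ≫ pullback.snd q g, by
      rw [Category.assoc, ← pq.w, IsIso.inv_hom_id_assoc]⟩
  · rintro ⟨d, rfl⟩
    have pl := hM.isPullback_of_isPushout po hl
    have w : e.a₁ ≫ m = (e.a₂ ≫ d) ≫ g := by rw [pb.w, Category.assoc]
    have w' : 𝟙 _ ≫ e.a₁ = pl.lift _ _ w ≫ l := by rw [pl.lift_fst, Category.id_comp]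
    have := hM.mono _ (hM.mem_fst_of_isPullback e.isPullback' hl)
    have hs := e.isPullback'.lift_fst _ _ w'
    exact ⟨e.isPullback'.lift _ _ w', by
      rw [← cancel_mono e.k, Category.assoc, hs, Category.comp_id, Category.id_comp], hs⟩

end ProtoEssence

end ProtoEssence

/-! ### Restriction of transformations -/

/-- A transformation restricts along an `M`-morphism through which the match factors. -/
lemma Transformation.exists_restrict [HasPullbacks C] (hM : IsAdhesiveHLR M) {ρ : Rule M} {G X : C}
    (t : Transformation ρ G) {x : X ⟶ G} (mx : M x) {m : ρ.L ⟶ X} (hm : m ≫ x = t.m) :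
    ∃ t' : Transformation ρ X, t'.m = m := by
  obtain ⟨Z, kZ, z, r', -, -, -, po⟩ := hM.exists_restrict t.isPushout_left ρ.l_mem mx hm
  have := hM.hasPushout ρ.r kZ ρ.r_mem
  exact ⟨⟨m, _, _, _, _, _, _, po, IsPushout.of_hasPushout ρ.r kZ⟩, rfl⟩

/-- The factorization of an embedding is an embedding of the same overlap, since `M`-morphisms are
mono, and the transformations restrict to it. -/
lemma RuleOverlap.IsEmbedding.embedsMinimally [HasPullbacks C] (hM : IsAdhesiveHLR M)
    (F : PairFactorization M) {ρ₁ ρ₂ : Rule M} {G : C} {ro : RuleOverlap ρ₁ ρ₂}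
    {t₁ : Transformation ρ₁ G} {t₂ : Transformation ρ₂ G} {q₁ : ro.P₁ ⟶ G} {q₂ : ro.P₂ ⟶ G}
    (h : ro.IsEmbedding t₁ t₂ q₁ q₂) : ro.EmbedsMinimally F := by
  obtain ⟨X, e₁, e₂, x, he, mx, rfl, rfl⟩ := F.exists_fac q₁ q₂
  have := hM.mono x mx
  obtain ⟨s₁, hs₁⟩ := t₁.exists_restrict hM mx ((Category.assoc _ _ _).trans h.fac₁)
  obtain ⟨s₂, hs₂⟩ := t₂.exists_restrict hM mx ((Category.assoc _ _ _).trans h.fac₂)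
  exact ⟨X, e₁, e₂, s₁, s₂, he, hs₁.symm, hs₂.symm,
    isPullback_of_comp_mono (j := x) (i := 𝟙 G) h.isPullback (by simp) (by simp)⟩

/-! ### Paths in the tree of a condition -/

namespace Cond

lemma AllInM.isMNormal {P : C} {c : Cond P} (h : c.AllInM M) : c.IsMNormal M := by
  induction c with
  | tt => trivial
  | neg c ih => exact ih h
  | conj I c ih => exact fun i => ih i (h i)
  | ex p d ih => exact h.2

lemma exists_cons_of_not_isEdgeless {P : C} (c : Cond P) (pol : Bool) (hc : ¬ c.IsEdgeless) :
    ∃ (Q R : C) (k : Binder) (p : P ⟶ Q) (t : Chain Q R), IsRootLeafPath pol c (.cons k p t) := by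
  induction c generalizing pol with
  | tt => exact absurd trivial hc
  | neg c ih =>
    obtain ⟨Q, R, k, p, t, h⟩ := ih (!pol) hc
    exact ⟨Q, R, k, p, t, .neg _ _ _ _ _ h⟩
  | conj I c ih =>
    obtain ⟨i, hi⟩ := not_forall.mp hc
    obtain ⟨Q, R, k, p, t, h⟩ := ih i pol hi
    exact ⟨Q, R, k, p, t, .conj _ _ _ _ _ _ _ h⟩
  | ex p d ih =>
    by_cases hd : d.IsEdgeless
    · exact ⟨_, _, _, p, _, .ex _ _ _ _ (.leaf _ _ hd)⟩
    · obtain ⟨Q, R, k, p', t, h⟩ := ih pol hd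
      exact ⟨_, _, _, p, _, .ex _ _ _ _ h⟩

lemma exists_isRootLeafPath {P : C} (c : Cond P) (pol : Bool) :
    ∃ (R : C) (ch : Chain P R), IsRootLeafPath pol c ch := by
  by_cases hc : c.IsEdgeless
  · exact ⟨_, _, .leaf _ _ hc⟩
  · obtain ⟨Q, R, k, p, t, h⟩ := c.exists_cons_of_not_isEdgeless pol hc
    exact ⟨_, _, h⟩

end Cond

lemma IsRootLeafPath.mem_comp (hM : IsAdhesiveHLR M) {P R : C} {pol : Bool} {c : Cond P}
    {ch : Chain P R} (h : IsRootLeafPath pol c ch) (hc : c.AllInM M) : M ch.comp := by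
  induction h with
  | leaf => exact hM.mem_id _
  | neg _ _ _ _ _ _ ih => exact ih hc
  | conj _ _ _ i _ _ _ _ ih => exact ih (hc i)
  | ex _ _ _ _ _ ih => exact hM.mem_comp hc.1 (ih hc.2)

namespace Chain

lemma levelsFrom_zero {P R : C} (k : Binder) (ch : Chain P R) :
    (ch.levelsFrom k)[0]? = some ⟨P, k, 𝟙 P, ch.comp⟩ := by
  cases ch <;> rfl

lemma length_levelsFrom {P R : C} (k : Binder) (ch : Chain P R) :
    (ch.levelsFrom k).length = ch.length + 1 := by
  induction ch generalizing k with
  | nil => rfl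
  | cons k' p t ih => simp [levelsFrom, length, ih]

lemma levelsFrom_succ {P Q R : C} (k k' : Binder) (p : P ⟶ Q) (t : Chain Q R) (i : ℕ) :
    ((cons k' p t).levelsFrom k)[i + 1]? =
      ((t.levelsFrom k')[i]?).map (fun ℓ => ⟨ℓ.obj, ℓ.binder, p ≫ ℓ.fromRoot, ℓ.toLeaf⟩) := by
  simp [levelsFrom]

end Chain

/-- The recursion selects the first level with a nontrivial proto-essence. -/
lemma isSelectedLevel_of_first_nontrivial {K L P R X : C} {l : K ⟶ L} {eL : L ⟶ X} {eP : R ⟶ X}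
    {ch : Chain P R} (hex : ∀ ℓ : Level P R, Nonempty (ProtoEssence M l eL (ℓ.toLeaf ≫ eP)))
    {s N : ℕ} (hs : s ≤ N) {ℓ : Level P R} (hℓ : ch.levels[N]? = some ℓ)
    (htriv : ∀ j < N, ∀ ℓ', ch.levels[j]? = some ℓ' →
      ∀ e : ProtoEssence M l eL (ℓ'.toLeaf ≫ eP), e.IsTrivial)
    (hnontriv : ∀ e : ProtoEssence M l eL (ℓ.toLeaf ≫ eP), ¬ e.IsTrivial) :
    IsSelectedLevel M l eL eP ch s ch.length ℓ := by
  have hlen : ch.levels.length = ch.length + 1 := ch.length_levelsFrom _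
  have hN : N < ch.levels.length := (List.getElem?_eq_some_iff.mp hℓ).1
  have before : ∀ j, s ≤ j → j ≤ N → ∀ ℓ', ch.levels[j]? = some ℓ' →
      IsSelectedLevel M l eL eP ch s j ℓ' := by
    intro j hj
    induction j, hj using Nat.le_induction with
    | base => exact fun _ ℓ' h' => .start ℓ' h'
    | succ j hj ih =>
      intro hjN ℓ' h'
      obtain ⟨e⟩ := hex (ch.levels[j]'(by omega))
      have hget : ch.levels[j]? = some (ch.levels[j]'(by omega)) :=
        List.getElem?_eq_getElem (by omega)
      exact .next j _ ℓ' e (ih (by omega) _ hget) (htriv j (by omega) _ hget e) h'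
  have after : ∀ j, N ≤ j → j ≤ ch.length → IsSelectedLevel M l eL eP ch s j ℓ := by
    intro j hj
    induction j, hj using Nat.le_induction with
    | base => exact fun _ => before N hs le_rfl ℓ hℓ
    | succ j hj ih =>
      intro hjn
      obtain ⟨e⟩ := hex ℓ
      exact .keep j ℓ e (ih (by omega)) (by omega) (hnontriv e)
  exact after _ (by omega) le_rfl

/-! ### Escaping a subobject along a path -/

/-- A witness that, along the chain `ch` from `P` to `R`, the objects up to some level `i` are
mapped into the subobject `y : D ⟶ Y`, starting with `q : P ⟶ D`, while the object of the level `i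
+ 1` is embedded in `Y` by an `M`-morphism that does not factor through `y`. The morphisms into
`Y` are compared after an extension `s : Y ⟶ X`, into which the whole chain is mapped by `eP : R ⟶
X`. The first object of the chain has binder `k`, the one of the level `i + 1` has binder `kind`.
-/
structure Chain.Escape (M : MorphismProperty C) {D Y P R : C} (y : D ⟶ Y) (q : P ⟶ D)
    (k kind : Binder) (ch : Chain P R) where
  X : C
  s : Y ⟶ X
  eP : R ⟶ X
  i : ℕ
  ℓ : Level P R
  q' : ℓ.obj ⟶ Y
  s_mem : M s
  eP_mem : M eP
  q'_mem : M q'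
  level : (ch.levelsFrom k)[i + 1]? = some ℓ
  binder : ℓ.binder = kind
  fromRoot : ℓ.fromRoot ≫ q' = q ≫ y
  toLeaf : ℓ.toLeaf ≫ eP = q' ≫ s
  start : q ≫ y ≫ s = ch.comp ≫ eP
  not_fac : ¬ ∃ d : ℓ.obj ⟶ D, d ≫ y = q'
  fac : ∀ j ≤ i, ∀ ℓ', (ch.levelsFrom k)[j]? = some ℓ' →
    ∃ d : ℓ'.obj ⟶ D, d ≫ y ≫ s = ℓ'.toLeaf ≫ eP

namespace Chain

variable {D Y P Q R : C} {y : D ⟶ Y} {q : P ⟶ D} {p : P ⟶ Q}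

lemma Escape.exists_eq_cons {k kind : Binder} {ch : Chain P R} (E : ch.Escape M y q k kind) :
    ∃ (Q : C) (k' : Binder) (p : P ⟶ Q) (t : Chain Q R), ch = cons k' p t := by
  cases ch with
  | nil => simpa [levelsFrom] using E.level
  | cons k' p t => exact ⟨_, k', p, t, rfl⟩

/-- A chain escapes at level `1` if its second object is embedded in `Y` outside of `D`. -/
lemma nonempty_escape_here (hM : IsAdhesiveHLR M) {k k' : Binder} {t : Chain Q R}
    (ht : M t.comp) {q' : Q ⟶ Y} (hq' : M q') (w : p ≫ q' = q ≫ y)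
    (hne : ¬ ∃ d : Q ⟶ D, d ≫ y = q') : Nonempty ((cons k' p t).Escape M y q k k') := by
  have := hM.hasPushout q' t.comp hq'
  -- Extending `Y` by the remaining path makes the leaf available without changing anything in `Y`.
  have po := IsPushout.of_hasPushout q' t.comp
  have hs : q ≫ y ≫ pushout.inl q' t.comp = (p ≫ t.comp) ≫ pushout.inr q' t.comp := by
    rw [← reassoc_of% w, po.w, Category.assoc]
  refine ⟨⟨_, pushout.inl q' t.comp, pushout.inr q' t.comp, 0, ⟨Q, k', p ≫ 𝟙 Q, t.comp⟩, q',
    hM.mem_inr_of_isPushout po.flip ht, hM.mem_inr_of_isPushout po hq', hq', ?_, rfl, ?_,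
    po.w.symm, hs, hne, ?_⟩⟩
  · rw [levelsFrom_succ, levelsFrom_zero, Option.map_some]
  · simpa using w
  · intro j hj ℓ' h'
    obtain rfl : j = 0 := by omega
    rw [levelsFrom_zero, Option.some_inj] at h'
    subst h'
    exact ⟨q, hs⟩

/-- If the second object of the chain is mapped into `D`, then an escape of the tail is one of the
whole chain. -/
lemma Escape.nonempty_cons {k k' kind : Binder} {t : Chain Q R} {q' : Q ⟶ D}
    (E : t.Escape M y q' k' kind) (w : p ≫ q' = q) :
    Nonempty ((cons k' p t).Escape M y q k kind) := by
  have hs : q ≫ y ≫ E.s = (p ≫ t.comp) ≫ E.eP := by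
    rw [← w, Category.assoc, E.start, Category.assoc]
  refine ⟨⟨E.X, E.s, E.eP, E.i + 1, ⟨E.ℓ.obj, E.ℓ.binder, p ≫ E.ℓ.fromRoot, E.ℓ.toLeaf⟩, E.q',
    E.s_mem, E.eP_mem, E.q'_mem, ?_, E.binder, ?_, E.toLeaf, hs, E.not_fac, ?_⟩⟩
  · rw [levelsFrom_succ, E.level, Option.map_some]
  · rw [Category.assoc, E.fromRoot, ← w, Category.assoc]
  · intro j hj ℓ' h'
    cases j with
    | zero =>
      rw [levelsFrom_zero, Option.some_inj] at h'
      subst h'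
      exact ⟨q, hs⟩
    | succ j =>
      rw [levelsFrom_succ, Option.map_eq_some_iff] at h'
      obtain ⟨ℓ'', h'', rfl⟩ := h'
      exact E.fac j (by omega) ℓ'' h''

end Chain

/-- If `D` is embedded in `G` and `H` and a condition distinguishes the two images of `q : P ⟶ D`,
then some existentially bound object is found in `G`, or some universally bound one in `H`, that
does not come from `D`. The polarity tells in which of `G` and `H` the condition holds. -/
lemma exists_escape (hM : IsAdhesiveHLR M) {D G H : C} {g : D ⟶ G} {h : D ⟶ H} (mg : M g)
    (mh : M h) {P : C} (c : Cond P) : ∀ (_ : c.IsMNormal M) (q : P ⟶ D) (pol : Bool) (k : Binder)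
      (_ : c.Sat M (q ≫ g) ↔ pol = true) (_ : c.Sat M (q ≫ h) ↔ pol = false),
      ∃ (R : C) (ch : Chain P R), IsRootLeafPath pol c ch ∧
        (Nonempty (ch.Escape M g q k .exist) ∨ Nonempty (ch.Escape M h q k .univ)) := by
  have toCons {P R : C} {q : P ⟶ D} {k : Binder} {ch : Chain P R}
      (hE : Nonempty (ch.Escape M g q k .exist) ∨ Nonempty (ch.Escape M h q k .univ)) :
      ∃ (Q : C) (k' : Binder) (p : P ⟶ Q) (t : Chain Q R), ch = .cons k' p t := by
    rcases hE with ⟨⟨E⟩⟩ | ⟨⟨E⟩⟩ <;> exact E.exists_eq_cons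
  induction c with
  | tt P =>
    intro _ q pol k hg hh
    simp only [Cond.Sat, true_iff] at hg hh
    simp [hg] at hh
  | neg c ih =>
    intro hc q pol k hg hh
    obtain ⟨R, ch, hch, hE⟩ := ih hc q (!pol) k
      (by cases pol <;> simpa [Cond.Sat] using hg) (by cases pol <;> simpa [Cond.Sat] using hh)
    obtain ⟨Q, k', p, t, rfl⟩ := toCons hE
    exact ⟨R, _, .neg _ _ _ _ _ hch, hE⟩
  | conj I c ih =>
    intro hc q pol k hg hh
    obtain ⟨i, hgi, hhi⟩ : ∃ i, ((c i).Sat M (q ≫ g) ↔ pol = true) ∧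
        ((c i).Sat M (q ≫ h) ↔ pol = false) := by
      cases pol with
      | true =>
        simp only [Cond.Sat, iff_true, Bool.true_eq_false, iff_false, not_forall] at hg hh ⊢
        exact hh.imp fun i hi => ⟨hg i, hi⟩
      | false =>
        simp only [Cond.Sat, iff_true, Bool.false_eq_true, iff_false, not_forall] at hg hh ⊢
        exact hg.imp fun i hi => ⟨hi, hh i⟩
    obtain ⟨R, ch, hch, hE⟩ := ih i (hc i) q pol k hgi hhi
    obtain ⟨Q, k', p, t, rfl⟩ := toCons hE
    exact ⟨R, _, .conj _ _ _ _ _ _ _ hch, hE⟩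
  | ex p d ih =>
    intro hc q pol k hg hh
    have := hM.mono g mg
    have := hM.mono h mh
    obtain ⟨R, t, ht⟩ := d.exists_isRootLeafPath pol
    have mt := ht.mem_comp hM hc
    cases pol with
    | true =>
      simp only [iff_true, Bool.true_eq_false, iff_false] at hg hh
      obtain ⟨q', mq', w, hsat⟩ := hg
      by_cases hd : ∃ q'', q'' ≫ g = q'
      · obtain ⟨q'', rfl⟩ := hd
        have mq'' := hM.decomposition _ _ mq' mg
        have w' : p ≫ q'' = q := by rw [← cancel_mono g, Category.assoc, w]
        have hnot : ¬ d.Sat M (q'' ≫ h) := fun hs =>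
          hh ⟨_, hM.mem_comp mq'' mh, by rw [← w', Category.assoc], hs⟩
        obtain ⟨R, t, ht, hE⟩ := ih hc.isMNormal q'' true _ (by simpa using hsat)
          (by simpa using hnot)
        exact ⟨R, _, .ex _ _ _ _ ht, hE.imp (fun ⟨E⟩ => E.nonempty_cons w')
          (fun ⟨E⟩ => E.nonempty_cons w')⟩
      · exact ⟨R, _, .ex _ _ _ _ ht, .inl (Chain.nonempty_escape_here hM mt mq' w hd)⟩
    | false =>
      simp only [iff_true, Bool.false_eq_true, iff_false] at hg hh
      obtain ⟨q', mq', w, hsat⟩ := hh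
      by_cases hd : ∃ q'', q'' ≫ h = q'
      · obtain ⟨q'', rfl⟩ := hd
        have mq'' := hM.decomposition _ _ mq' mh
        have w' : p ≫ q'' = q := by rw [← cancel_mono h, Category.assoc, w]
        have hnot : ¬ d.Sat M (q'' ≫ g) := fun hs =>
          hg ⟨_, hM.mem_comp mq'' mg, by rw [← w', Category.assoc], hs⟩
        obtain ⟨R, t, ht, hE⟩ := ih hc.isMNormal q'' false _ (by simpa using hnot)
          (by simpa using hsat)
        exact ⟨R, _, .ex _ _ _ _ ht, hE.imp (fun ⟨E⟩ => E.nonempty_cons w')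
          (fun ⟨E⟩ => E.nonempty_cons w')⟩
      · exact ⟨R, _, .ex _ _ _ _ ht, .inr (Chain.nonempty_escape_here hM mt mq' w hd)⟩

/-! ### Disabling essences of a pair of transformations -/

/-- The level at which a chain first escapes the context of a pushout along `l` is the one
selected for the proto-essence under `l`, whether the recursion starts at level `0` or `1`. -/
lemma Chain.Escape.exists_protoEssence [HasPullbacks C] (hM : IsAdhesiveHLR M)
    (hInit : HasMInitial M) (hIPO : HasInitialPushouts M) (F : PairFactorization M)
    {K L P R D Y : C} {l : K ⟶ L} (hl : M l) {k₀ : K ⟶ D} {m : L ⟶ Y} {y : D ⟶ Y}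
    (po : IsPushout l k₀ m y) {q : P ⟶ D} {ch : Chain P R} {kind : Binder}
    (E : ch.Escape M y q .root kind) {s : ℕ} (hs : s ≤ 1) :
    ∃ (X : C) (eL : L ⟶ X) (eP : R ⟶ X) (e : ProtoEssence M l eL (E.ℓ.toLeaf ≫ eP)),
      F.E' eL eP ∧ M eP ∧ IsSelectedLevel M l eL eP ch s ch.length E.ℓ ∧ ¬ e.IsTrivial ∧
        IsPullback e.a₁ e.a₂ m E.q' := by
  obtain ⟨X, eL, eP, x, he, mx, hx₁, hx₂⟩ := F.exists_fac (m ≫ E.s) E.eP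
  have := hM.mono x mx
  have := hM.mono _ E.s_mem
  have hpb {Q : C} {f : Q ⟶ R} {f' : Q ⟶ Y} (w : f ≫ E.eP = f' ≫ E.s)
      (e : ProtoEssence M l eL (f ≫ eP)) : IsPullback e.a₁ e.a₂ m f' :=
    isPullback_of_comp_mono e.isPullback hx₁ (by rw [Category.assoc, hx₂, w])
  have hex (ℓ : Level P R) := ConflictEssences.exists_protoEssence hM hIPO hl eL (ℓ.toLeaf ≫ eP)
  have hnt (e : ProtoEssence M l eL (E.ℓ.toLeaf ≫ eP)) : ¬ e.IsTrivial := by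
    rw [e.isTrivial_iff_exists_fac hM hInit hl po (hpb E.toLeaf e)]
    exact E.not_fac
  obtain ⟨e⟩ := hex E.ℓ
  refine ⟨X, eL, eP, e, he, hM.decomposition _ _ (hx₂ ▸ E.eP_mem) mx, ?_, hnt e, hpb E.toLeaf e⟩
  refine isSelectedLevel_of_first_nontrivial hex (by omega) E.level (fun j hj ℓ' h' e' => ?_) hnt
  obtain ⟨d, hd⟩ := E.fac j (by omega) ℓ' h'
  have w : ℓ'.toLeaf ≫ E.eP = (d ≫ y) ≫ E.s := by rw [← hd, Category.assoc]
  exact (e'.isTrivial_iff_exists_fac hM hInit hl po (hpb w e')).mpr ⟨d, rfl⟩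

section Pair

variable {ρ₁ ρ₂ : Rule M} {G : C} {t₁ : Transformation ρ₁ G} {t₂ : Transformation ρ₂ G}

lemma Chain.Escape.exists_disablingEssence_deletion [HasPullbacks C] (hM : IsAdhesiveHLR M)
    (hInit : HasMInitial M) (hIPO : HasInitialPushouts M) (F : PairFactorization M)
    {d : ρ₂.L ⟶ t₁.D} (hd : d ≫ t₁.g = t₂.m) {R : C} {ch : Chain ρ₂.L R}
    (hch : IsRootLeafPath true ρ₂.ac ch) (E : ch.Escape M t₁.g d .root .exist) :
    ∃ ro : RuleOverlap ρ₁ ρ₂, DisablingEssence F ρ₁ ρ₂ ro ∧ M ro.b₁ ∧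
      ∃ q₁ q₂, ro.IsEmbedding t₁ t₂ q₁ q₂ := by
  obtain ⟨X, eL, eP, e, he, mP, hsel, hnt, pb⟩ :=
    E.exists_protoEssence hM hInit hIPO F ρ₁.l_mem t₁.isPushout_left (Nat.zero_le 1)
  have emb : RuleOverlap.IsEmbedding (ρ₁ := ρ₁) (ρ₂ := ρ₂)
      ⟨e.A, ρ₁.L, E.ℓ.obj, e.a₁, e.a₂, 𝟙 _, E.ℓ.fromRoot⟩ t₁ t₂ t₁.m E.q' :=
    ⟨Category.id_comp _, E.fromRoot.trans hd, pb⟩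
  exact ⟨_, .deletion ch eL eP E.ℓ e ⟨⟨he, .inr ⟨hch, mP⟩⟩, hsel⟩ (.inl E.binder) hnt
    (emb.embedsMinimally hM F), hM.mem_fst_of_isPullback pb E.q'_mem, _, _, emb⟩

/-- The escaping object is found in `H₁`; the overlap with `R₁` is moved back to one with `L₁` by
restricting the pushout of `r₁` along the morphism into `H₁`. -/
lemma Chain.Escape.exists_disablingEssence_insertion [HasPullbacks C] (hM : IsAdhesiveHLR M)
    (hInit : HasMInitial M) (hIPO : HasInitialPushouts M) (F : PairFactorization M)
    {d : ρ₂.L ⟶ t₁.D} (hd : d ≫ t₁.g = t₂.m) {R : C} {ch : Chain ρ₂.L R}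
    (hch : IsRootLeafPath true ρ₂.ac ch) (E : ch.Escape M t₁.h d .root .univ) :
    ∃ ro : RuleOverlap ρ₁ ρ₂, DisablingEssence F ρ₁ ρ₂ ro ∧ M ro.b₁ ∧
      ∃ q₁ q₂, ro.IsEmbedding t₁ t₂ q₁ q₂ := by
  obtain ⟨X, eR, eP, e, he, mP, hsel, hnt, pb⟩ :=
    E.exists_protoEssence hM hInit hIPO F ρ₁.r_mem t₁.isPushout_right le_rfl
  -- The object `P'` is the part of the escaping object that already exists in the context of `t₁`.
  have pq := IsPullback.of_hasPullback E.q' t₁.h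
  obtain ⟨a', po, pa⟩ := e.exists_isPushout hM ρ₁.r_mem t₁.isPushout_right pb pq
  have my := hM.mem_fst_of_isPullback pq.flip E.q'_mem
  have pG := pa.flip.paste_horiz (hM.isPullback_of_isPushout t₁.isPushout_left ρ₁.l_mem)
  have emb : RuleOverlap.IsEmbedding (ρ₁ := ρ₁) (ρ₂ := ρ₂)
      ⟨e.A', ρ₁.L, _, e.k' ≫ ρ₁.l, a', 𝟙 _, pq.lift _ _ E.fromRoot⟩ t₁ t₂ t₁.m
        (pullback.snd E.q' t₁.h ≫ t₁.g) :=
    ⟨Category.id_comp _, by rw [← Category.assoc, pq.lift_snd, hd], pG⟩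
  exact ⟨_, .insertion ch eR eP E.ℓ e ⟨⟨he, .inr ⟨hch, mP⟩⟩, hsel⟩ E.binder hnt _ a' _ po _
    (pq.lift_fst _ _ E.fromRoot) (emb.embedsMinimally hM F),
    hM.mem_fst_of_isPullback pG (hM.mem_comp my (t₁.mem_g hM)), _, _, emb⟩

/-- If `t₁` preserves the match of `t₂` but invalidates the application condition of `ρ₂`, then a
disabling essence of `ρ₁` in `ρ₂` embeds in the pair. -/
lemma exists_disablingEssence_of_not_sat [HasPullbacks C] (hM : IsAdhesiveHLR M)
    (hInit : HasMInitial M) (hIPO : HasInitialPushouts M) (F : PairFactorization M)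
    (h₂ : t₂.SatisfiesAC) {d : ρ₂.L ⟶ t₁.D} (hd : d ≫ t₁.g = t₂.m)
    (hns : ¬ ρ₂.ac.Sat M (d ≫ t₁.h)) :
    ∃ ro : RuleOverlap ρ₁ ρ₂, DisablingEssence F ρ₁ ρ₂ ro ∧ M ro.b₁ ∧
      ∃ q₁ q₂, ro.IsEmbedding t₁ t₂ q₁ q₂ := by
  obtain ⟨R, ch, hch, ⟨⟨E⟩⟩ | ⟨⟨E⟩⟩⟩ := exists_escape hM (t₁.mem_g hM) (t₁.mem_h hM) ρ₂.ac
    ρ₂.ac_normal d true .root (by rw [hd]; exact iff_of_true h₂ rfl) (by simpa using hns)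
  · exact E.exists_disablingEssence_deletion hM hInit hIPO F hd hch
  · exact E.exists_disablingEssence_insertion hM hInit hIPO F hd hch

/-- If `t₁` destroys the match of `t₂`, then the pullback of the two matches is a disabling essence
that embeds in no pair in which the first transformation preserves the second match. -/
lemma exists_disablingEssence_of_not_fac [HasPullbacks C] (hM : IsAdhesiveHLR M)
    (hInit : HasMInitial M) (hIPO : HasInitialPushouts M) (F : PairFactorization M)
    (hd : ¬ ∃ d : ρ₂.L ⟶ t₁.D, d ≫ t₁.g = t₂.m) :
    ∃ ro : RuleOverlap ρ₁ ρ₂, DisablingEssence F ρ₁ ρ₂ ro ∧ ro.IsPlain ∧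
      (∀ (G' : C) (t₁' : Transformation ρ₁ G') (t₂' : Transformation ρ₂ G') (q₁ : ro.P₁ ⟶ G')
        (q₂ : ro.P₂ ⟶ G'), ro.IsEmbedding t₁' t₂' q₁ q₂ →
          ¬ ∃ d : ρ₂.L ⟶ t₁'.D, d ≫ t₁'.g = t₂'.m) ∧
      ∃ q₁ q₂, ro.IsEmbedding t₁ t₂ q₁ q₂ := by
  obtain ⟨X, eL, eP, x, he, mx, hx₁, hx₂⟩ := F.exists_fac t₁.m t₂.m
  have := hM.mono x mx
  obtain ⟨e⟩ := exists_protoEssence hM hIPO ρ₁.l_mem eL (𝟙 _ ≫ eP)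
  have pb : IsPullback e.a₁ e.a₂ t₁.m t₂.m :=
    isPullback_of_comp_mono (j := 𝟙 G) e.isPullback (by simpa) (by simpa)
  have hnt : ¬ e.IsTrivial := by
    rwa [e.isTrivial_iff_exists_fac hM hInit ρ₁.l_mem t₁.isPushout_left pb]
  have emb : RuleOverlap.IsEmbedding (ρ₁ := ρ₁) (ρ₂ := ρ₂)
      ⟨e.A, ρ₁.L, ρ₂.L, e.a₁, e.a₂, 𝟙 _, 𝟙 _⟩ t₁ t₂ t₁.m t₂.m :=
    ⟨Category.id_comp _, Category.id_comp _, pb⟩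
  refine ⟨_, .deletion (.nil _) eL eP ⟨ρ₂.L, .root, 𝟙 _, 𝟙 _⟩ e ⟨⟨he, .inl rfl⟩, .start _ rfl⟩
    (.inr rfl) hnt (emb.embedsMinimally hM F), ⟨_, _, _, rfl⟩, ?_, _, _, emb⟩
  intro G' t₁' t₂' q₁ q₂ emb'
  obtain rfl : q₁ = t₁'.m := (Category.id_comp q₁).symm.trans emb'.fac₁
  obtain rfl : q₂ = t₂'.m := (Category.id_comp q₂).symm.trans emb'.fac₂
  rwa [← e.isTrivial_iff_exists_fac hM hInit ρ₁.l_mem t₁'.isPushout_left emb'.isPullback]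

lemma RuleOverlap.IsEmbedding.swap {ro : RuleOverlap ρ₁ ρ₂} {q₁ : ro.P₁ ⟶ G} {q₂ : ro.P₂ ⟶ G}
    (h : ro.IsEmbedding t₁ t₂ q₁ q₂) : ro.swap.IsEmbedding t₂ t₁ q₂ q₁ :=
  ⟨h.fac₂, h.fac₁, h.isPullback.flip⟩

/-! ### Conflict essences of parallel dependent transformations -/

/-- On an embedding of an overlap that has a pushout, the cospan condition of the overlap expresses
that the pair consists of transformations and is parallel dependent, provided that it is parallel
independent ac-disregarding. -/
lemma RuleOverlap.IsEmbedding.sat_ex_iff [HasPullbacks C] [HasBinaryCoproducts C]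
    (hM : IsAdhesiveHLR M) (F : PairFactorization M) {ce : RuleOverlap ρ₁ ρ₂} {q₁ : ce.P₁ ⟶ G}
    {q₂ : ce.P₂ ⟶ G} (emb : ce.IsEmbedding t₁ t₂ q₁ q₂)
    (hind : ParallelIndependentACDisregarding t₁ t₂) {D : C} {d₁ : ce.P₁ ⟶ D} {d₂ : ce.P₂ ⟶ D}
    (po : IsPushout ce.b₁ ce.b₂ d₁ d₂) :
    (CospanCond.ex d₁ d₂ ((symbolicInitialConflictAC F ρ₁ ρ₂).shift F
      (coprod.desc (ce.p₁ ≫ d₁) (ce.p₂ ≫ d₂)))).Sat M q₁ q₂ ↔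
        (t₁.SatisfiesAC ∧ t₂.SatisfiesAC) ∧ ParallelDependent t₁ t₂ := by
  have key {f : D ⟶ G} (h₁ : d₁ ≫ f = q₁) (h₂ : d₂ ≫ f = q₂) :
      ((symbolicInitialConflictAC F ρ₁ ρ₂).shift F
        (coprod.desc (ce.p₁ ≫ d₁) (ce.p₂ ≫ d₂))).Sat M f ↔
          (t₁.SatisfiesAC ∧ t₂.SatisfiesAC) ∧ ParallelDependent t₁ t₂ := by
    rw [Cond.sat_shift hM, coprod.desc_comp, Category.assoc, Category.assoc, h₁, h₂, emb.fac₁,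
      emb.fac₂, sat_symbolicInitialConflictAC hM F t₁ t₂ hind]
  constructor
  · rintro ⟨f, hf, h₁, h₂⟩
    exact (key h₁ h₂).mp hf
  · intro h
    have h₁ := po.inl_desc q₁ q₂ emb.isPullback.w
    have h₂ := po.inr_desc q₁ q₂ emb.isPullback.w
    exact ⟨_, (key h₁ h₂).mpr h, h₁, h₂⟩

/-- An embedded plain disabling essence that is not ac-conflicting comes with the condition
`true`. -/
lemma exists_symbolicConflictEssence_of_plain [HasBinaryCoproducts C] (F : PairFactorization M)
    {ro : RuleOverlap ρ₁ ρ₂} (hro : DisablingEssence F ρ₁ ρ₂ ro ∨ DisablingEssence F ρ₂ ρ₁ ro.swap)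
    (hp : ro.IsPlain)
    (hnac : ¬ ro.IsACConflicting) (hemb : ∃ q₁ q₂, ro.IsEmbedding t₁ t₂ q₁ q₂) :
    ∃ (ce : RuleOverlap ρ₁ ρ₂) (ac : CospanCond ce.P₁ ce.P₂),
      IsSymbolicConflictEssence F ρ₁ ρ₂ ce ac ∧ IsSymbolicallyEmbeddable ce ac t₁ t₂ := by
  obtain ⟨q₁, q₂, emb⟩ := hemb
  exact ⟨ro, .tt, ⟨.disabling ro hro (.inr hp), fun h => absurd h hnac, fun _ => rfl⟩,
    q₁, q₂, emb, trivial⟩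

/-- On a pair that is parallel independent ac-disregarding, every embedded disabling essence is
ac-conflicting by definition, and its cospan condition holds because the pair is parallel
dependent. -/
lemma exists_symbolicConflictEssence_of_independent [HasPullbacks C]
    [HasBinaryCoproducts C] (hM : IsAdhesiveHLR M)
    (F : PairFactorization M) (h₁ : t₁.SatisfiesAC) (h₂ : t₂.SatisfiesAC)
    (hind : ParallelIndependentACDisregarding t₁ t₂) (hdep : ParallelDependent t₁ t₂)
    {ro : RuleOverlap ρ₁ ρ₂}
    (hro : DisablingEssence F ρ₁ ρ₂ ro ∨ DisablingEssence F ρ₂ ρ₁ ro.swap)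
    (hpo : HasPushout ro.b₁ ro.b₂) (hemb : ∃ q₁ q₂, ro.IsEmbedding t₁ t₂ q₁ q₂) :
    ∃ (ce : RuleOverlap ρ₁ ρ₂) (ac : CospanCond ce.P₁ ce.P₂),
      IsSymbolicConflictEssence F ρ₁ ρ₂ ce ac ∧ IsSymbolicallyEmbeddable ce ac t₁ t₂ := by
  have hac : ro.IsACConflicting := ⟨G, t₁, t₂, hind, hemb⟩
  obtain ⟨q₁, q₂, emb⟩ := hemb
  have po := IsPushout.of_hasPushout ro.b₁ ro.b₂
  exact ⟨ro, _, ⟨.disabling ro hro (.inl hac), fun _ => ⟨_, _, _, po, rfl⟩,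
    fun h => absurd hac h⟩, q₁, q₂, emb, (emb.sat_ex_iff hM F hind po).mpr ⟨⟨h₁, h₂⟩, hdep⟩⟩

end Pair

end ConflictEssences

theorem mainTheorem1 {C : Type u} [Category.{v} C] [HasPullbacks C] [HasBinaryCoproducts C]
    {M : MorphismProperty C} (hM : ConflictEssences.IsAdhesiveHLR M)
    (hInit : ConflictEssences.HasMInitial M) (hIPO : ConflictEssences.HasInitialPushouts M)
    (F : ConflictEssences.PairFactorization M)
    (ρ₁ ρ₂ : ConflictEssences.Rule M) {G : C}
    (t₁ : ConflictEssences.Transformation ρ₁ G) (t₂ : ConflictEssences.Transformation ρ₂ G)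
    (h₁ : t₁.SatisfiesAC) (h₂ : t₂.SatisfiesAC) :
    ConflictEssences.ParallelDependent t₁ t₂ ↔
      ∃ (ce : ConflictEssences.RuleOverlap ρ₁ ρ₂)
        (ac : ConflictEssences.CospanCond ce.P₁ ce.P₂),
        ConflictEssences.IsSymbolicConflictEssence F ρ₁ ρ₂ ce ac ∧
          ConflictEssences.IsSymbolicallyEmbeddable ce ac t₁ t₂ := by
  open ConflictEssences in
  constructor
  · intro hdep
    by_cases hd₁ : ∃ d₁ : ρ₂.L ⟶ t₁.D, d₁ ≫ t₁.g = t₂.m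
    swap
    · obtain ⟨ro, hro, hp, hno, hemb⟩ :=
        exists_disablingEssence_of_not_fac hM hInit hIPO F hd₁
      refine exists_symbolicConflictEssence_of_plain F (.inl hro) hp ?_ hemb
      rintro ⟨G', t₁', t₂', ⟨d, -, hd, -⟩, q₁, q₂, emb⟩
      exact hno G' t₁' t₂' q₁ q₂ emb ⟨d, hd⟩
    by_cases hd₂ : ∃ d₂ : ρ₁.L ⟶ t₂.D, d₂ ≫ t₂.g = t₁.m
    swap
    · obtain ⟨ro, hro, ⟨A, b₁, b₂, rfl⟩, hno, q₁, q₂, emb⟩ :=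
        exists_disablingEssence_of_not_fac hM hInit hIPO F hd₂
      refine exists_symbolicConflictEssence_of_plain F
        (ro := RuleOverlap.swap ⟨A, ρ₂.L, ρ₁.L, b₁, b₂, 𝟙 _, 𝟙 _⟩) (.inr hro) ⟨A, b₂, b₁, rfl⟩ ?_
        ⟨q₂, q₁, emb.swap⟩
      rintro ⟨G', t₁', t₂', ⟨-, d, -, hd⟩, q₁, q₂, emb⟩
      exact hno G' t₂' t₁' q₂ q₁ emb.swap ⟨d, hd⟩
    obtain ⟨d₁, hd₁⟩ := hd₁
    obtain ⟨d₂, hd₂⟩ := hd₂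
    have hind : ParallelIndependentACDisregarding t₁ t₂ := ⟨d₁, d₂, hd₁, hd₂⟩
    by_cases hs : ρ₂.ac.Sat M (d₁ ≫ t₁.h)
    · have hs' : ¬ ρ₁.ac.Sat M (d₂ ≫ t₂.h) := fun h => hdep ⟨d₁, d₂, hd₁, hd₂, hs, h⟩
      obtain ⟨ro, hro, hb, q₁, q₂, emb⟩ :=
        exists_disablingEssence_of_not_sat hM hInit hIPO F h₁ hd₂ hs'
      have := hM.hasPushout ro.b₁ ro.b₂ hb
      exact exists_symbolicConflictEssence_of_independent hM F h₁ h₂ hind hdep (ro := ro.swap)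
        (.inr hro) (IsPushout.of_hasPushout ro.b₁ ro.b₂).flip.hasPushout ⟨q₂, q₁, emb.swap⟩
    · obtain ⟨ro, hro, hb, hemb⟩ :=
        exists_disablingEssence_of_not_sat hM hInit hIPO F h₂ hd₁ hs
      exact exists_symbolicConflictEssence_of_independent hM F h₁ h₂ hind hdep (.inl hro)
        (hM.hasPushout ro.b₁ ro.b₂ hb) hemb
  · rintro ⟨ce, ac, ⟨-, hac, -⟩, q₁, q₂, emb, hsat⟩ ⟨d₁, d₂, hd₁, hd₂, hs⟩
    -- A parallel independent pair makes every overlap embedded in it ac-conflicting.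
    have hind : ParallelIndependentACDisregarding t₁ t₂ := ⟨d₁, d₂, hd₁, hd₂⟩
    obtain ⟨D, e₁, e₂, po, rfl⟩ := hac ⟨G, t₁, t₂, hind, q₁, q₂, emb⟩
    exact ((emb.sat_ex_iff hM F hind po).mp hsat).2 ⟨d₁, d₂, hd₁, hd₂, hs⟩
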